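/- Let $m\ge 0$ be an integer. For $\tau\in\mathbb C$ with $\operatorname{Im}\tau>0$ write $q^{x}=e^{2\pi i\tau x}$. For an integer $k\ge 1$ and $j\in\mathbb Z/2k\mathbb Z$ put $$\Theta_{j,k}(\tau,z)=\sum_{n\in\mathbb Z+\frac{j}{2k}}q^{kn^2}e^{2\pi i knz},$$ $$R_{k;j}(\tau,v)=\sum_{\substack{n\in\mathbb Z\\ n\equiv j \bmod 2k}}\left(\operatorname{sign}\left(n+\tfrac12\right)-E\left(\left(n+2k\tfrac{\operatorname{Im}v}{\operatorname{Im}\tau}\right)\left(\tfrac{\operatorname{Im}\tau}{k}\right)^{1/2}\right)\right)e^{-\frac{\pi i n^2}{2k}\tau-2\pi i nv},$$ where $E(x)=2\int_0^x e^{-\pi s^2}\,ds$. For $z_1,z_2,t\in\mathbb C$ with $z_1,z_2\notin\mathbb Z+\mathbb Z\tau$ put $$\Phi^{[m]}(\tau,z_1,z_2,t)=e^{2\pi i(m+1)t}\sum_{j\in\mathbb Z}\left(\frac{e^{2\pi ij(m+1)(z_1+z_2)}q^{j^2(m+1)}}{1-e^{2\pi iz_1}q^j}-\frac{e^{-2\pi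 ij(m+1)(z_1+z_2)}q^{j^2(m+1)}}{1-e^{-2\pi iz_2}q^j}\right),$$ $$\Phi^{[m]}_{\mathrm{add}}(\tau,z_1,z_2,t)=-\tfrac12e^{2\pi i(m+1)t}\sum_{j\in\mathbb Z/(2m+2)\mathbb Z}R_{m+1;j}\left(\tau,\tfrac{z_1-z_2}{2}\right)\left(\Theta_{j,m+1}-\Theta_{-j,m+1}\right)(\tau,z_1+z_2),$$ and $\tilde\Phi^{[m]}=\Phi^{[m]}+\Phi^{[m]}_{\mathrm{add}}$. For $u,v,t\in\mathbb C$ with $v-u,\,-u-v\notin\mathbb Z+\mathbb Z\tau$ put $\varphi^{[m]}(\tau,u,v,t)=\Phi^{[m]}(\tau,v-u,-u-v,t)$, $$\varphi^{[m]}_{\mathrm{add}}(\tau,u,v,t)=\tfrac12e^{2\pi i(m+1)t}\sum_{j\in\mathbb Z/(2m+2)\mathbb Z}R_{m+1;j}(\tau,v)\left(\Theta_{j,m+1}-\Theta_{-j,m+1}\right)(\tau,2u),$$ and $\tilde\varphi^{[m]}=\varphi^{[m]}+\varphi^{[m]}_{\mathrm{add}}$. All the series above converge absolutely. **Theorem.**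 Let $\operatorname{Im}\tau>0$ and $u,v,t\in\mathbb C$ with $v-u,\,-u-v\notin\mathbb Z+\mathbb Z\tau$. Then: (a) $\tilde\varphi^{[m]}\left(-\frac1\tau,\frac u\tau,\frac v\tau,t-\frac{u^2-v^2}{\tau}\right)=\tau\,\tilde\varphi^{[m]}(\tau,u,v,t)$. (b) $\tilde\varphi^{[m]}(\tau,u+a,v+b,t)=\tilde\varphi^{[m]}(\tau,u,v,t)$ if $a,b\in\frac12\mathbb Z$ are such that $a+b\in\mathbb Z$. (c) $\tilde\varphi^{[m]}(\tau,u,-v,t)=\tilde\varphi^{[m]}(\tau,u,v,t)$ and $\tilde\varphi^{[m]}(\tau,-u,v,t)=-\tilde\varphi^{[m]}(\tau,u,v,t)$. (d) $\tilde\varphi^{[m]}(\tau+1,u,v,t)=\tilde\varphi^{[m]}(\tau,u,v,t)$. (e) $\tilde\varphi^{[m]}(\tau,u+a\tau,v+b\tau,t)=q^{(m+1)(b^2-a^2)}e^{4\pi i(m+1)(-au+bv)}\,\tilde\varphi^{[m]}(\tau,u,v,t)$ if $a,b\in\frac12\mathbb Z$ are such that $a+b\in\mathbb Z$. **Corollary.**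 Let $\operatorname{Im}\tau>0$ and $z_1,z_2,t\in\mathbb C$ with $z_1,z_2\notin\mathbb Z+\mathbb Z\tau$. Then $\tilde\Phi^{[m]}(\tau,z_1,z_2,t)=\tilde\varphi^{[m]}\left(\tau,-\frac{z_1+z_2}{2},\frac{z_1-z_2}{2},t\right)$, and: (a) $\tilde\Phi^{[m]}\left(-\frac1\tau,\frac{z_1}\tau,\frac{z_2}\tau,t-\frac{z_1z_2}{\tau}\right)=\tau\,\tilde\Phi^{[m]}(\tau,z_1,z_2,t)$. (b) $\tilde\Phi^{[m]}(\tau,z_1+a,z_2+b,t)=\tilde\Phi^{[m]}(\tau,z_1,z_2,t)$ if $a,b\in\mathbb Z$. (c) $\tilde\Phi^{[m]}(\tau,-z_1,-z_2,t)=-\tilde\Phi^{[m]}(\tau,z_1,z_2,t)$ and $\tilde\Phi^{[m]}(\tau,z_2,z_1,t)=\tilde\Phi^{[m]}(\tau,z_1,z_2,t)$. (d) $\tilde\Phi^{[m]}(\tau+1,z_1,z_2,t)=\tilde\Phi^{[m]}(\tau,z_1,z_2,t)$. (e) $\tilde\Phi^{[m]}(\tau,z_1+j\tau,z_2+k\tau,t)=q^{-(m+1)jk}e^{-2\pi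 i(m+1)(kz_1+jz_2)}\,\tilde\Phi^{[m]}(\tau,z_1,z_2,t)$ if $j,k\in\mathbb Z$. -/

import Mathlib

noncomputable section

namespace ModifiedNumerator

/-- `q ^ x` for `q = e^{2πiτ}`, with the branch fixed by `τ`. -/
def qPow (τ x : ℂ) : ℂ := Complex.exp (2 * Real.pi * Complex.I * τ * x)

/-- `e^{2πi x}`. -/
def e (x : ℂ) : ℂ := Complex.exp (2 * Real.pi * Complex.I * x)

/-- The general term of `Θ_{j,k}(τ, z) = ∑_{n ∈ ℤ + j/(2k)} q^{k n²} e^{2πi k n z}`,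
where `n` is replaced by `n + j/(2k)` with `n ∈ ℤ`. -/
def thetaTerm (j : ℤ) (k : ℕ) (τ z : ℂ) (n : ℤ) : ℂ :=
  qPow τ (k * ((n : ℂ) + j / (2 * k)) ^ 2) * e (k * ((n : ℂ) + j / (2 * k)) * z)

/-- The theta function `Θ_{j,k}(τ, z)` of degree `k`. -/
def Theta (j : ℤ) (k : ℕ) (τ z : ℂ) : ℂ := ∑' n : ℤ, thetaTerm j k τ z n

/-- The odd function `E(x) = 2 ∫₀ˣ e^{-π u²} du`, at real arguments. -/
def E (x : ℝ) : ℝ := 2 * ∫ u in (0 : ℝ)..x, Real.exp (-Real.pi * u ^ 2)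

/-- The term with index `n` of the series for Zwegers' function `R_{m;j}(τ, v)`. -/
def zwegersTerm (m : ℕ) (τ v : ℂ) (n : ℤ) : ℂ :=
  ((Real.sign ((n : ℝ) + 1 / 2) -
      E (((n : ℝ) + 2 * m * (v.im / τ.im)) * Real.sqrt (τ.im / m)) : ℝ) : ℂ) *
    Complex.exp (-(Real.pi * Complex.I * (n : ℂ) ^ 2 / (2 * m)) * τ -
      2 * Real.pi * Complex.I * n * v)

/-- Zwegers' function `R_{m;j}(τ, v)`: the sum over the integers `n ≡ j mod 2m`. -/
def zwegersR (m : ℕ) (j : ℤ) (τ v : ℂ) : ℂ :=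
  ∑' n : {n : ℤ // n ≡ j [ZMOD 2 * m]}, zwegersTerm m τ v n

/-- The general term of the series for `Φ^{[m]}`, without the factor `e^{2πi(m+1)t}`. -/
def numeratorTerm (m : ℕ) (τ z₁ z₂ : ℂ) (j : ℤ) : ℂ :=
  e (j * (m + 1) * (z₁ + z₂)) * qPow τ ((j : ℂ) ^ 2 * (m + 1)) / (1 - e z₁ * qPow τ j) -
    e (-(j * (m + 1) * (z₁ + z₂))) * qPow τ ((j : ℂ) ^ 2 * (m + 1)) / (1 - e (-z₂) * qPow τ j)

/-- The numerator `Φ^{[m]}(τ, z₁, z₂, t)`. -/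
def Phi (m : ℕ) (τ z₁ z₂ t : ℂ) : ℂ :=
  e ((m + 1) * t) * ∑' j : ℤ, numeratorTerm m τ z₁ z₂ j

/-- The numerator `φ^{[m]}(τ, u, v, t)` in the coordinates `u = -(z₁ + z₂)/2`,
`v = (z₁ - z₂)/2`, that is, `z₁ = v - u`, `z₂ = -u - v`. -/
def phi (m : ℕ) (τ u v t : ℂ) : ℂ := Phi m τ (v - u) (-u - v) t

/-- `Θ_{j,k}(τ, z)` depends on `j` modulo `2k` only. -/
theorem Theta_add_two_mul (j : ℤ) (k : ℕ) (hk : k ≠ 0) (τ z : ℂ) :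
    Theta (j + 2 * k) k τ z = Theta j k τ z := by
  have hk' : (k : ℂ) ≠ 0 := Nat.cast_ne_zero.mpr hk
  unfold Theta
  rw [← (Equiv.addRight (1 : ℤ)).tsum_eq (thetaTerm j k τ z)]
  refine tsum_congr fun n => ?_
  have h : (n : ℂ) + ((j + 2 * k : ℤ) : ℂ) / (2 * k) = ((n + 1 : ℤ) : ℂ) + j / (2 * k) := by
    push_cast
    field_simp
    ring
  simp only [thetaTerm, Equiv.coe_addRight, h]

/-- `R_{m;j}(τ, v)` depends on `j` modulo `2m` only. -/
theorem zwegersR_add_two_mul (m : ℕ) (j : ℤ) (τ v : ℂ) :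
    zwegersR m (j + 2 * m) τ v = zwegersR m j τ v := by
  have h : (fun n : ℤ => n ≡ j + 2 * m [ZMOD 2 * m]) = fun n : ℤ => n ≡ j [ZMOD 2 * m] := by
    funext n
    simp [Int.ModEq]
  exact congrArg (fun p : ℤ → Prop => ∑' n : {n : ℤ // p n}, zwegersTerm m τ v n) h

/-- The correction `φ^{[m]}_add(τ, u, v, t)`; the sum over `ℤ/(2m+2)ℤ` is taken over the
representatives `0, …, 2m+1`. -/
def phiAdd (m : ℕ) (τ u v t : ℂ) : ℂ :=
  1 / 2 * e ((m + 1) * t) * ∑ j ∈ Finset.range (2 * m + 2),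
    zwegersR (m + 1) j τ v * (Theta j (m + 1) τ (2 * u) - Theta (-j) (m + 1) τ (2 * u))

/-- The modified numerator `φ̃^{[m]}(τ, u, v, t)`. -/
def phiTilde (m : ℕ) (τ u v t : ℂ) : ℂ := phi m τ u v t + phiAdd m τ u v t

/-- The correction `Φ^{[m]}_add(τ, z₁, z₂, t)`. -/
def PhiAdd (m : ℕ) (τ z₁ z₂ t : ℂ) : ℂ :=
  -(1 / 2) * e ((m + 1) * t) * ∑ j ∈ Finset.range (2 * m + 2),
    zwegersR (m + 1) j τ ((z₁ - z₂) / 2) *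
      (Theta j (m + 1) τ (z₁ + z₂) - Theta (-j) (m + 1) τ (z₁ + z₂))

/-- The modified numerator `Φ̃^{[m]}(τ, z₁, z₂, t)`. -/
def PhiTilde (m : ℕ) (τ z₁ z₂ t : ℂ) : ℂ := Phi m τ z₁ z₂ t + PhiAdd m τ z₁ z₂ t

/-- The points off the polar divisor of `Φ^{[m]}`: neither `z₁` nor `z₂` lies in `ℤ + ℤτ`. -/
def IsRegular (τ z₁ z₂ : ℂ) : Prop :=
  ∀ j k : ℤ, z₁ ≠ j + k * τ ∧ z₂ ≠ j + k * τ

/-- `a, b ∈ ½ℤ` and `a + b ∈ ℤ`. -/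
def IsHalfIntegralPair (a b : ℝ) : Prop :=
  (∃ k : ℤ, a = k / 2) ∧ (∃ l : ℤ, b = l / 2) ∧ ∃ n : ℤ, a + b = n

end ModifiedNumerator

end

/-!
Split `Φ̃` into the two Appell sums of its defining series, each completed by its half of the
correction: `φ̃(u, v) = e((m+1)t) (A(-u, v) - A(u, v))`, where `A` is the completed Appell sum of
index `m + 1`. The elliptic transformations and `τ ↦ τ + 1` are rearrangements of series. For
`τ ↦ -1/τ`, Zwegers' argument applies to the difference `D(v)` of the two sides. The
antiholomorphic derivative of the completion is an elementary factor times
`∑ conj Θ_j(2v) Θ_j(2u)`, which is modular by Poisson summation and the unitarity of the discrete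
Fourier transform, so that `D` is holomorphic off the lattice translates of `u`. Equal residues make
these singularities removable, and `D` satisfies `D(v + 1) = D(v)` and
`D(v + τ) = e((m+1)(2v + τ)) D(v)`. Hence `|D(v)| exp(2π(m+1)(Im v)²/Im τ)` is doubly periodic, so
bounded, and `D = 0` by Liouville's theorem.
-/

noncomputable section

namespace ModifiedNumerator

open Complex Filter Topology
open scoped ComplexConjugate Real

theorem e_add (x y : ℂ) : e (x + y) = e x * e y := by
  simp only [e, mul_add, Complex.exp_add]

theorem e_zero : e 0 = 1 := by simp [e]

theorem e_neg (x : ℂ) : e (-x) = (e x)⁻¹ := by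
  simp only [e, mul_neg, Complex.exp_neg]

theorem e_ne_zero (x : ℂ) : e x ≠ 0 := Complex.exp_ne_zero _

theorem e_eq_one_iff {x : ℂ} : e x = 1 ↔ ∃ n : ℤ, x = n := by
  rw [e, Complex.exp_eq_one_iff]
  refine exists_congr fun n => ?_
  rw [mul_comm (n : ℂ)]
  exact mul_right_inj' Complex.two_pi_I_ne_zero

theorem e_intCast (n : ℤ) : e n = 1 := e_eq_one_iff.mpr ⟨n, rfl⟩

theorem e_eq_e_of_eq_add_intCast {x y : ℂ} (n : ℤ) (h : x = y + n) : e x = e y := by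
  rw [h, e_add, e_intCast, mul_one]

theorem e_natCast_mul (k : ℕ) (x : ℂ) : e (k * x) = e x ^ k := by
  rw [e, e, ← Complex.exp_nat_mul, mul_left_comm]

theorem qPow_eq_e (τ x : ℂ) : qPow τ x = e (τ * x) := by
  simp only [qPow, e, mul_assoc]

theorem norm_e (x : ℂ) : ‖e x‖ = Real.exp (-2 * π * x.im) := by
  simp [e, Complex.norm_exp]

theorem conj_e (x : ℂ) : conj (e x) = e (-conj x) := by
  rw [e, e, ← Complex.exp_conj]
  simp only [map_mul, Complex.conj_ofReal, Complex.conj_I, Complex.conj_ofNat]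
  ring_nf

theorem hasDerivAt_e (x : ℂ) : HasDerivAt e (2 * π * I * e x) x := by
  rw [mul_comm]
  exact (hasDerivAt_const_mul (2 * π * I : ℂ)).cexp

@[fun_prop]
theorem differentiable_e : Differentiable ℂ e := fun x => (hasDerivAt_e x).differentiableAt

@[fun_prop]
theorem continuous_e : Continuous e := differentiable_e.continuous

theorem tsum_int_eq_sum_range_tsum {A : Type*} [AddCommGroup A] [UniformSpace A]
    [IsUniformAddGroup A] [CompleteSpace A] [T2Space A] (N : ℕ) [NeZero N] {g : ℤ → A}
    (hg : Summable g) : ∑' n, g n = ∑ j ∈ Finset.range N, ∑' k : ℤ, g (j + N * k) := by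
  let split : ℤ ≃ Fin N × ℤ := (Int.divModEquiv N).trans (Equiv.prodComm _ _)
  have hsplit : Summable fun c => g (split.symm c) := split.symm.summable_iff.mpr hg
  rw [← split.symm.tsum_eq, hsplit.tsum_prod, tsum_fintype, Finset.sum_range]
  refine Finset.sum_congr rfl fun i _ => tsum_congr fun k => congrArg g ?_
  simp [split, add_comm, mul_comm]

/-- The parametrisation `k ↦ j + N k` of a residue class by the integers. -/
def residueEquiv (N j : ℤ) (hN : N ≠ 0) : ℤ ≃ {n : ℤ // n ≡ j [ZMOD N]} where
  toFun k := ⟨j + N * k, by simp [Int.ModEq]⟩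
  invFun n := (n - j) / N
  left_inv k := by simp [hN]
  right_inv := by
    rintro ⟨n, hn⟩
    ext
    change j + N * ((n - j) / N) = n
    rw [Int.mul_ediv_cancel' (Int.modEq_iff_dvd.mp hn.symm)]
    ring

theorem hasDerivAt_E (x : ℝ) : HasDerivAt E (2 * Real.exp (-π * x ^ 2)) x := by
  have hc : Continuous fun u : ℝ => Real.exp (-π * u ^ 2) := by fun_prop
  exact (intervalIntegral.integral_hasDerivAt_right (hc.intervalIntegrable _ _)
    (hc.stronglyMeasurableAtFilter _ _) hc.continuousAt).const_mul 2

theorem E_neg (x : ℝ) : E (-x) = -E x := by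
  have h := intervalIntegral.integral_comp_neg (a := 0) (b := x) fun u => Real.exp (-π * u ^ 2)
  simp only [neg_sq, neg_zero] at h
  rw [E, E, h, intervalIntegral.integral_symm, mul_neg]

theorem integrable_exp_neg_pi_mul_sq :
    MeasureTheory.Integrable fun u : ℝ => Real.exp (-π * u ^ 2) :=
  integrable_exp_neg_mul_sq Real.pi_pos

theorem integral_Ioi_exp_neg_pi_mul_sq :
    ∫ u in Set.Ioi (0 : ℝ), Real.exp (-π * u ^ 2) = 1 / 2 := by
  rw [integral_gaussian_Ioi, div_self Real.pi_ne_zero, Real.sqrt_one]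

theorem one_sub_E_eq_integral (x : ℝ) :
    1 - E x = 2 * ∫ s in Set.Ioi (0 : ℝ), Real.exp (-π * (s + x) ^ 2) := by
  have hshift : ∫ s in Set.Ioi (0 : ℝ), Real.exp (-π * (s + x) ^ 2) =
      ∫ s in Set.Ioi x, Real.exp (-π * s ^ 2) := by
    have hmap := (MeasureTheory.measurePreserving_add_right
      MeasureTheory.volume x).setIntegral_preimage_emb (measurableEmbedding_addRight x)
      (fun u : ℝ => Real.exp (-π * u ^ 2)) (Set.Ioi x)
    simpa using hmap
  have hsplit := intervalIntegral.integral_interval_add_Ioi (a := 0) (b := x)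
    integrable_exp_neg_pi_mul_sq.integrableOn integrable_exp_neg_pi_mul_sq.integrableOn
  rw [integral_Ioi_exp_neg_pi_mul_sq] at hsplit
  rw [hshift, E]
  linarith

theorem one_sub_E_nonneg (x : ℝ) : 0 ≤ 1 - E x := by
  rw [one_sub_E_eq_integral]
  exact mul_nonneg zero_le_two (MeasureTheory.integral_nonneg fun s => (Real.exp_pos _).le)

theorem one_sub_E_le_two (x : ℝ) : 1 - E x ≤ 2 := by
  have h := one_sub_E_nonneg (-x)
  rw [E_neg] at h
  linarith

theorem one_sub_E_le_exp {x : ℝ} (hx : 0 ≤ x) : 1 - E x ≤ Real.exp (-π * x ^ 2) := by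
  have h : ∫ s in Set.Ioi (0 : ℝ), Real.exp (-π * (s + x) ^ 2) ≤
      ∫ s in Set.Ioi (0 : ℝ), Real.exp (-π * x ^ 2) * Real.exp (-π * s ^ 2) := by
    refine MeasureTheory.setIntegral_mono_on
      (integrable_exp_neg_pi_mul_sq.comp_add_right x).integrableOn
      (integrable_exp_neg_pi_mul_sq.const_mul _).integrableOn measurableSet_Ioi fun s hs => ?_
    rw [← Real.exp_add, Real.exp_le_exp]
    have : 0 ≤ π * (s * x) := mul_nonneg Real.pi_pos.le (mul_nonneg (le_of_lt hs) hx)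
    nlinarith
  rw [MeasureTheory.integral_const_mul, integral_Ioi_exp_neg_pi_mul_sq] at h
  rw [one_sub_E_eq_integral]
  linarith

theorem one_sub_E_le_two_mul_exp {a x : ℝ} (h : a ≤ x) :
    1 - E x ≤ 2 * Real.exp (π * (a ^ 2 - x ^ 2)) := by
  rcases le_or_gt 0 x with hx | hx
  · have hexp : Real.exp (-π * x ^ 2) ≤ Real.exp (π * (a ^ 2 - x ^ 2)) :=
      Real.exp_le_exp.mpr (by nlinarith [Real.pi_pos, sq_nonneg a])
    linarith [one_sub_E_le_exp hx, Real.exp_pos (π * (a ^ 2 - x ^ 2))]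
  · have hexp : 1 ≤ Real.exp (π * (a ^ 2 - x ^ 2)) :=
      Real.one_le_exp (mul_nonneg Real.pi_pos.le (by nlinarith))
    linarith [one_sub_E_le_two x]

theorem sign_intCast_add_half (n : ℤ) :
    Real.sign ((n : ℝ) + 1 / 2) = if 0 ≤ n then 1 else -1 := by
  split_ifs with h
  · have : (0 : ℝ) ≤ n := by exact_mod_cast h
    exact Real.sign_of_pos (by linarith)
  · have : (n : ℝ) ≤ -1 := by exact_mod_cast (by omega : n ≤ -1)
    exact Real.sign_of_neg (by linarith)

theorem abs_sign_sub_E_le (n : ℤ) (c : ℝ) {s : ℝ} (hs : 0 ≤ s) :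
    |Real.sign ((n : ℝ) + 1 / 2) - E ((n + c) * s)| ≤
      2 * Real.exp (π * ((c * s) ^ 2 - ((n + c) * s) ^ 2)) := by
  rw [sign_intCast_add_half]
  split_ifs with hn
  · rw [abs_of_nonneg (one_sub_E_nonneg _)]
    have : (0 : ℝ) ≤ n := by exact_mod_cast hn
    exact one_sub_E_le_two_mul_exp (by nlinarith)
  · have hreflect : |-1 - E ((n + c) * s)| = 1 - E (-((n + c) * s)) := by
      rw [← abs_of_nonneg (one_sub_E_nonneg _), E_neg, ← abs_neg]
      ring_nf
    have : (n : ℝ) ≤ 0 := by exact_mod_cast (not_le.mp hn).le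
    rw [hreflect, ← neg_sq (c * s), ← neg_sq ((n + c) * s)]
    exact one_sub_E_le_two_mul_exp (by nlinarith)

section ThetaExponentials

variable {M : ℕ} {τ : ℂ}

/-- The exponential `e^{2πi n v} q^{n²/(4M)}`, from which the terms of `Θ_{j,M}(τ, 2v)`, of
`R_{M;j}(τ, v)` and of the Appell sums are built. -/
def thetaExp (M : ℕ) (τ v : ℂ) (n : ℤ) : ℂ := e (n * v + n ^ 2 / (4 * M) * τ)

theorem thetaExp_ne_zero (v : ℂ) (n : ℤ) : thetaExp M τ v n ≠ 0 := e_ne_zero _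

theorem thetaExp_eq_jacobiTheta₂_term (v : ℂ) (n : ℤ) :
    thetaExp M τ v n = jacobiTheta₂_term n v (τ / (2 * M)) := by
  rw [thetaExp, e, jacobiTheta₂_term]
  ring_nf

theorem im_div_two_mul_natCast : (τ / (2 * M)).im = τ.im / (2 * M) := by
  have h : (2 * M : ℂ) = ((2 * M : ℝ) : ℂ) := by push_cast; rfl
  rw [h, Complex.div_ofReal_im]

theorem summable_thetaExp [NeZero M] (hτ : 0 < τ.im) (v : ℂ) : Summable (thetaExp M τ v) := by
  have hM : (0 : ℝ) < M := Nat.cast_pos.mpr (NeZero.pos M)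
  refine ((summable_jacobiTheta₂_term_iff v (τ / (2 * M))).mpr ?_).congr fun n =>
    (thetaExp_eq_jacobiTheta₂_term v n).symm
  rw [im_div_two_mul_natCast]
  positivity

theorem exists_summable_bound_thetaExp [NeZero M] (hτ : 0 < τ.im) (v : ℂ) :
    ∃ w : ℤ → ℝ, Summable w ∧
      ∀ n : ℤ, ∀ x ∈ Metric.ball v 1, (1 + |(n : ℝ)|) * ‖thetaExp M τ x n‖ ≤ w n := by
  have hM : (0 : ℝ) < M := Nat.cast_pos.mpr (NeZero.pos M)
  have hT : 0 < τ.im / (2 * M) := by positivity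
  have hsum := summable_pow_mul_jacobiTheta₂_term_bound (|v.im| + 1) hT
  refine ⟨_, (hsum 0).add (hsum 1), fun n x hx => ?_⟩
  have him : |x.im| ≤ |v.im| + 1 := by
    have hdist : |(x - v).im| < 1 :=
      (Complex.abs_im_le_norm _).trans_lt (mem_ball_iff_norm.mp hx)
    rw [Complex.sub_im] at hdist
    linarith [abs_sub_abs_le_abs_sub x.im v.im]
  have hterm := norm_jacobiTheta₂_term_le hT him im_div_two_mul_natCast.ge n
  rw [Int.cast_abs] at hterm
  rw [thetaExp_eq_jacobiTheta₂_term, Int.cast_abs, pow_zero, pow_one, ← add_mul]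
  gcongr

theorem add_two_mul_mul_injective [NeZero M] (j : ℤ) :
    Function.Injective fun k : ℤ => j + 2 * M * k :=
  fun k k' h => by simpa [NeZero.ne M] using h

theorem norm_thetaExp (v : ℂ) (n : ℤ) :
    ‖thetaExp M τ v n‖ = Real.exp (-2 * π * (n * v.im + n ^ 2 / (4 * M) * τ.im)) := by
  have h : (n * v + n ^ 2 / (4 * M) * τ : ℂ) =
      ((n : ℝ) : ℂ) * v + ((n ^ 2 / (4 * M) : ℝ) : ℂ) * τ := by push_cast; rfl
  rw [thetaExp, norm_e, h, Complex.add_im, Complex.im_ofReal_mul, Complex.im_ofReal_mul]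

theorem thetaTerm_two_mul [NeZero M] (j : ℤ) (v : ℂ) (k : ℤ) :
    thetaTerm j M τ (2 * v) k = thetaExp M τ v (j + 2 * M * k) := by
  have hM : (M : ℂ) ≠ 0 := NeZero.ne _
  rw [thetaTerm, qPow_eq_e, ← e_add, thetaExp]
  congr 1
  push_cast
  field_simp
  ring

theorem summable_thetaTerm [NeZero M] (hτ : 0 < τ.im) (j : ℤ) (z : ℂ) :
    Summable (thetaTerm j M τ z) := by
  refine ((summable_thetaExp (M := M) hτ (z / 2)).comp_injective
    (add_two_mul_mul_injective (M := M) j)).congr fun k => ?_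
  rw [Function.comp_apply, ← thetaTerm_two_mul, mul_div_cancel₀ _ two_ne_zero]

theorem Theta_two_mul [NeZero M] (j : ℤ) (v : ℂ) :
    Theta j M τ (2 * v) = ∑' k : ℤ, thetaExp M τ v (j + 2 * M * k) :=
  tsum_congr (thetaTerm_two_mul j v)

theorem zwegersR_eq_tsum [NeZero M] (j : ℤ) (v : ℂ) :
    zwegersR M j τ v = ∑' k : ℤ, zwegersTerm M τ v (j + 2 * M * k) :=
  ((residueEquiv (2 * M) j (NeZero.ne _)).tsum_eq fun n => zwegersTerm M τ v n).symm

/-- The argument of `E` in `zwegersTerm`. -/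
def zwegersArg (M : ℕ) (τ v : ℂ) (n : ℤ) : ℝ :=
  ((n : ℝ) + 2 * M * (v.im / τ.im)) * Real.sqrt (τ.im / M)

theorem zwegersTerm_eq (v : ℂ) (n : ℤ) :
    zwegersTerm M τ v n =
      ((Real.sign ((n : ℝ) + 1 / 2) - E (zwegersArg M τ v n) : ℝ) : ℂ) *
        (thetaExp M τ v n)⁻¹ := by
  rw [zwegersTerm, zwegersArg, thetaExp, e, ← Complex.exp_neg]
  ring_nf

/-- Completing the square: the Gaussian in the derivative of `R` differs from a squared theta
exponential by a factor that does not depend on `n`. -/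
theorem exp_neg_pi_mul_zwegersArg_sq [NeZero M] (hτ : 0 < τ.im) (v : ℂ) (n : ℤ) :
    Real.exp (-π * zwegersArg M τ v n ^ 2) =
      Real.exp (-4 * π * M * v.im ^ 2 / τ.im) * ‖thetaExp M τ v n‖ ^ 2 := by
  have hM : (M : ℝ) ≠ 0 := NeZero.ne _
  rw [norm_thetaExp, ← Real.exp_nat_mul, ← Real.exp_add, zwegersArg, mul_pow,
    Real.sq_sqrt (by positivity)]
  congr 1
  push_cast
  field_simp
  ring

theorem abs_sign_sub_E_zwegersArg_le [NeZero M] (hτ : 0 < τ.im) (v : ℂ) (n : ℤ) :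
    |Real.sign ((n : ℝ) + 1 / 2) - E (zwegersArg M τ v n)| ≤ 2 * ‖thetaExp M τ v n‖ ^ 2 := by
  have hM : (M : ℝ) ≠ 0 := NeZero.ne _
  have hshift : (2 * M * (v.im / τ.im) * Real.sqrt (τ.im / M)) ^ 2 = 4 * M * v.im ^ 2 / τ.im := by
    rw [mul_pow, Real.sq_sqrt (by positivity)]
    field_simp
    ring
  refine (abs_sign_sub_E_le n _ (Real.sqrt_nonneg _)).trans_eq ?_
  rw [hshift, mul_sub, sub_eq_add_neg, ← neg_mul, Real.exp_add, ← zwegersArg,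
    exp_neg_pi_mul_zwegersArg_sq hτ, ← mul_assoc (Real.exp _), ← Real.exp_add]
  ring_nf
  simp

theorem norm_zwegersTerm_le [NeZero M] (hτ : 0 < τ.im) (v : ℂ) (n : ℤ) :
    ‖zwegersTerm M τ v n‖ ≤ 2 * ‖thetaExp M τ v n‖ := by
  have hpos : 0 < ‖thetaExp M τ v n‖ := norm_pos_iff.mpr (thetaExp_ne_zero v n)
  rw [zwegersTerm_eq, norm_mul, norm_inv, Complex.norm_real, Real.norm_eq_abs,
    ← div_eq_mul_inv, div_le_iff₀ hpos]
  exact (abs_sign_sub_E_zwegersArg_le hτ v n).trans_eq (by ring)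

theorem summable_zwegersTerm [NeZero M] (hτ : 0 < τ.im) (v : ℂ) :
    Summable (zwegersTerm M τ v) :=
  .of_norm_bounded ((summable_thetaExp hτ v).norm.mul_left 2) (norm_zwegersTerm_le hτ v)

end ThetaExponentials

section Wirtinger

/-- The real-linear map `h ↦ a h + b h̄`. -/
def wirtingerCLM (a b : ℂ) : ℂ →L[ℝ] ℂ :=
  a • ContinuousLinearMap.id ℝ ℂ + b • (Complex.conjCLE : ℂ →L[ℝ] ℂ)

theorem wirtingerCLM_apply (a b h : ℂ) : wirtingerCLM a b h = a * h + b * conj h := by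
  simp [wirtingerCLM]

theorem norm_wirtingerCLM_le (a b : ℂ) : ‖wirtingerCLM a b‖ ≤ ‖a‖ + ‖b‖ := by
  refine ContinuousLinearMap.opNorm_le_bound _ (by positivity) fun h => ?_
  rw [wirtingerCLM_apply, add_mul]
  exact (norm_add_le _ _).trans_eq (by simp)

/-- `f` is real differentiable at `v` with `∂f/∂v = a` and `∂f/∂v̄ = b`. -/
def HasWirtingerAt (f : ℂ → ℂ) (a b v : ℂ) : Prop := HasFDerivAt f (wirtingerCLM a b) v

variable {ι : Type*} {f g : ℂ → ℂ} {a b c d v : ℂ}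

theorem HasWirtingerAt.of_hasDerivAt (h : HasDerivAt f a v) : HasWirtingerAt f a 0 v := by
  refine h.complexToReal_fderiv.congr_fderiv ?_
  ext x
  simp [wirtingerCLM_apply]

theorem HasWirtingerAt.differentiableAt (h : HasWirtingerAt f a 0 v) : DifferentiableAt ℂ f v := by
  have hderiv : HasFDerivAt f (ContinuousLinearMap.toSpanSingleton ℂ a : ℂ →L[ℂ] ℂ) v := by
    refine hasFDerivAt_of_restrictScalars ℝ h ?_
    ext x
    simp [wirtingerCLM_apply, mul_comm]
  exact hderiv.differentiableAt

theorem HasWirtingerAt.sub (hf : HasWirtingerAt f a b v) (hg : HasWirtingerAt g c d v) :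
    HasWirtingerAt (fun x => f x - g x) (a - c) (b - d) v := by
  refine (HasFDerivAt.fun_sub hf hg).congr_fderiv ?_
  ext x
  simp only [sub_apply, wirtingerCLM_apply]
  ring

theorem HasWirtingerAt.mul (hf : HasWirtingerAt f a b v) (hg : HasWirtingerAt g c d v) :
    HasWirtingerAt (fun x => f x * g x) (f v * c + a * g v) (f v * d + b * g v) v := by
  refine (HasFDerivAt.mul hf hg).congr_fderiv ?_
  ext x
  simp only [add_apply, smul_apply, wirtingerCLM_apply, smul_eq_mul]
  ring

theorem HasWirtingerAt.sum {s : Finset ι} {f : ι → ℂ → ℂ} {a b : ι → ℂ}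
    (h : ∀ i ∈ s, HasWirtingerAt (f i) (a i) (b i) v) :
    HasWirtingerAt (fun x => ∑ i ∈ s, f i x) (∑ i ∈ s, a i) (∑ i ∈ s, b i) v := by
  refine (HasFDerivAt.fun_sum h).congr_fderiv ?_
  ext x
  simp [wirtingerCLM_apply, Finset.sum_add_distrib, Finset.sum_mul]

theorem HasWirtingerAt.comp_const_mul (h : HasWirtingerAt f a b (c * v)) :
    HasWirtingerAt (fun x => f (c * x)) (a * c) (b * conj c) v := by
  have hmul : HasFDerivAt (fun x : ℂ => c * x) (wirtingerCLM c 0) v :=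
    HasWirtingerAt.of_hasDerivAt (hasDerivAt_const_mul c)
  refine (HasFDerivAt.comp v h hmul).congr_fderiv ?_
  ext x
  simp only [ContinuousLinearMap.comp_apply, wirtingerCLM_apply, zero_mul, add_zero, map_mul]
  ring

theorem HasWirtingerAt.tsum {f a b : ι → ℂ → ℂ} {w : ι → ℝ} {r : ℝ} (hr : 0 < r)
    (hw : Summable w)
    (hf : ∀ i, ∀ x ∈ Metric.ball v r, HasWirtingerAt (f i) (a i x) (b i x) x)
    (ha : ∀ i, ∀ x ∈ Metric.ball v r, ‖a i x‖ ≤ w i)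
    (hb : ∀ i, ∀ x ∈ Metric.ball v r, ‖b i x‖ ≤ w i)
    (hfv : Summable fun i => f i v) :
    HasWirtingerAt (fun x => ∑' i, f i x) (∑' i, a i v) (∑' i, b i v) v := by
  have hv : v ∈ Metric.ball v r := Metric.mem_ball_self hr
  have hsa : Summable fun i => a i v := .of_norm_bounded hw fun i => ha i v hv
  have hsb : Summable fun i => b i v := .of_norm_bounded hw fun i => hb i v hv
  have hbound : ∀ i, ∀ x ∈ Metric.ball v r, ‖wirtingerCLM (a i x) (b i x)‖ ≤ w i + w i :=
    fun i x hx => (norm_wirtingerCLM_le _ _).trans (add_le_add (ha i x hx) (hb i x hx))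
  have hCLM : Summable fun i => wirtingerCLM (a i v) (b i v) :=
    .of_norm_bounded (hw.add hw) fun i => hbound i v hv
  refine (hasFDerivAt_tsum_of_isPreconnected (hw.add hw) Metric.isOpen_ball
    (convex_ball v r).isPreconnected hf hbound hv hfv hv).congr_fderiv ?_
  ext x
  have happly := (ContinuousLinearMap.apply ℝ ℂ x).map_tsum hCLM
  simp only [ContinuousLinearMap.apply_apply, wirtingerCLM_apply] at happly
  rw [happly, (hsa.mul_right x).tsum_add (hsb.mul_right _), tsum_mul_right, tsum_mul_right,
    wirtingerCLM_apply]

end Wirtinger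

section ZwegersDerivative

variable {M : ℕ} {τ : ℂ}

/-- The derivative with respect to `Im v` of the argument of `E` in `zwegersTerm`. -/
def zwegersSlope (M : ℕ) (τ : ℂ) : ℝ := 2 * M / τ.im * Real.sqrt (τ.im / M)

theorem hasFDerivAt_zwegersArg (v : ℂ) (n : ℤ) :
    HasFDerivAt (fun x : ℂ => zwegersArg M τ x n) (zwegersSlope M τ • Complex.imCLM) v := by
  have haffine : (fun x : ℂ => zwegersArg M τ x n) =
      fun x => n * Real.sqrt (τ.im / M) + zwegersSlope M τ * Complex.imCLM x := by
    funext x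
    simp only [zwegersArg, zwegersSlope, Complex.imCLM_apply]
    ring
  rw [haffine]
  exact (Complex.imCLM.hasFDerivAt.const_mul _).const_add _

theorem HasWirtingerAt.ofReal_comp_E_zwegersArg (s : ℝ) (v : ℂ) (n : ℤ) :
    HasWirtingerAt (fun x => ((s - E (zwegersArg M τ x n) : ℝ) : ℂ))
      (I * zwegersSlope M τ * Real.exp (-π * zwegersArg M τ v n ^ 2))
      (-I * zwegersSlope M τ * Real.exp (-π * zwegersArg M τ v n ^ 2)) v := by
  have hreal := ((hasDerivAt_E (zwegersArg M τ v n)).comp_hasFDerivAt v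
    (hasFDerivAt_zwegersArg v n)).const_sub s
  refine (Complex.ofRealCLM.hasFDerivAt.comp v hreal).congr_fderiv ?_
  ext x
  have him : (x.im : ℂ) = (conj x - x) * I / 2 := by
    apply Complex.ext <;> simp
  simp only [wirtingerCLM_apply, ContinuousLinearMap.comp_apply, neg_apply, smul_apply,
    Complex.imCLM_apply, Complex.ofRealCLM_apply, smul_eq_mul]
  push_cast
  rw [him]
  ring

theorem hasDerivAt_inv_thetaExp (v : ℂ) (n : ℤ) :
    HasDerivAt (fun x => (thetaExp M τ x n)⁻¹) (-(2 * π * I * n) * (thetaExp M τ v n)⁻¹) v := by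
  have hlinear : HasDerivAt (fun x : ℂ => -(n * x + n ^ 2 / (4 * M) * τ)) (-(n : ℂ)) v :=
    ((hasDerivAt_const_mul (n : ℂ)).add_const _).neg
  simp only [thetaExp, ← e_neg]
  exact ((hasDerivAt_e _).comp v hlinear).congr_deriv (by ring)

theorem exp_mul_inv_thetaExp [NeZero M] (hτ : 0 < τ.im) (v : ℂ) (n : ℤ) :
    (Real.exp (-π * zwegersArg M τ v n ^ 2) : ℂ) * (thetaExp M τ v n)⁻¹ =
      Real.exp (-4 * π * M * v.im ^ 2 / τ.im) * conj (thetaExp M τ v n) := by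
  rw [exp_neg_pi_mul_zwegersArg_sq hτ, Complex.ofReal_mul, Complex.ofReal_pow, ← Complex.conj_mul',
    mul_assoc, mul_inv_cancel_right₀ (thetaExp_ne_zero v n)]

/-- The quotient of `∂R_{M;j}/∂v̄` by the conjugate of `Θ_{j,M}(τ, 2v)`. -/
def dbarFactor (M : ℕ) (τ v : ℂ) : ℂ :=
  -I * zwegersSlope M τ * Real.exp (-4 * π * M * v.im ^ 2 / τ.im)

theorem norm_dbarFactor_le (hτ : 0 < τ.im) (v : ℂ) : ‖dbarFactor M τ v‖ ≤ |zwegersSlope M τ| := by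
  rw [dbarFactor, norm_mul, norm_mul, norm_neg, Complex.norm_I, one_mul, Complex.norm_real,
    Complex.norm_real, Real.norm_eq_abs, Real.norm_eq_abs, Real.abs_exp]
  refine mul_le_of_le_one_right (abs_nonneg _) (Real.exp_le_one_iff.mpr ?_)
  simp only [neg_mul, neg_div, neg_nonpos]
  positivity

theorem hasWirtingerAt_zwegersTerm [NeZero M] (hτ : 0 < τ.im) (v : ℂ) (n : ℤ) :
    HasWirtingerAt (fun x => zwegersTerm M τ x n)
      (zwegersTerm M τ v n * -(2 * π * I * n) - dbarFactor M τ v * conj (thetaExp M τ v n))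
      (dbarFactor M τ v * conj (thetaExp M τ v n)) v := by
  have hmul := (HasWirtingerAt.ofReal_comp_E_zwegersArg (M := M) (τ := τ)
    (Real.sign ((n : ℝ) + 1 / 2)) v n).mul
      (.of_hasDerivAt (hasDerivAt_inv_thetaExp (M := M) (τ := τ) v n))
  have hgauss : ∀ κ : ℂ, κ * Real.exp (-π * zwegersArg M τ v n ^ 2) * (thetaExp M τ v n)⁻¹ =
      κ * Real.exp (-4 * π * M * v.im ^ 2 / τ.im) * conj (thetaExp M τ v n) := fun κ => by
    rw [mul_assoc, mul_assoc, exp_mul_inv_thetaExp hτ]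
  rw [hgauss, hgauss] at hmul
  simp only [zwegersTerm_eq]
  convert hmul using 1 <;> rw [dbarFactor] <;> ring

theorem norm_dbarFactor_mul_conj_thetaExp_le (hτ : 0 < τ.im) (v : ℂ) (n : ℤ) :
    ‖dbarFactor M τ v * conj (thetaExp M τ v n)‖ ≤ |zwegersSlope M τ| * ‖thetaExp M τ v n‖ := by
  rw [norm_mul, RCLike.norm_conj]
  exact mul_le_mul_of_nonneg_right (norm_dbarFactor_le hτ v) (norm_nonneg _)

theorem norm_zwegersTerm_mul_le [NeZero M] (hτ : 0 < τ.im) (v : ℂ) (n : ℤ) :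
    ‖zwegersTerm M τ v n * -(2 * π * I * n)‖ ≤ 4 * π * |(n : ℝ)| * ‖thetaExp M τ v n‖ := by
  have hfactor : ‖-(2 * π * I * (n : ℂ))‖ = 2 * π * |(n : ℝ)| := by
    simp [abs_of_pos Real.pi_pos]
  rw [norm_mul, hfactor]
  calc _ ≤ 2 * ‖thetaExp M τ v n‖ * (2 * π * |(n : ℝ)|) := by
        gcongr
        exact norm_zwegersTerm_le hτ v n
    _ = _ := by ring

theorem exists_hasWirtingerAt_zwegersR [NeZero M] (hτ : 0 < τ.im) (j : ℤ) (v : ℂ) :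
    ∃ a, HasWirtingerAt (zwegersR M j τ) a (dbarFactor M τ v * conj (Theta j M τ (2 * v))) v := by
  obtain ⟨w, hw, hbound⟩ := exists_summable_bound_thetaExp (M := M) hτ v
  set C := 4 * π + |zwegersSlope M τ|
  have hle (n : ℤ) (x : ℂ) (hx : x ∈ Metric.ball v 1) :
      (4 * π * |(n : ℝ)| + |zwegersSlope M τ|) * ‖thetaExp M τ x n‖ ≤ C * w n := by
    refine le_trans ?_ (mul_le_mul_of_nonneg_left (hbound n x hx) (by positivity))
    rw [← mul_assoc]
    gcongr
    nlinarith [Real.pi_pos, abs_nonneg (n : ℝ), abs_nonneg (zwegersSlope M τ)]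
  have hR : zwegersR M j τ = fun x => ∑' k : ℤ, zwegersTerm M τ x (j + 2 * M * k) :=
    funext (zwegersR_eq_tsum j)
  rw [hR, Theta_two_mul, Complex.conj_tsum, ← tsum_mul_left]
  have hinj := add_two_mul_mul_injective (M := M) j
  refine ⟨_, HasWirtingerAt.tsum one_pos ((hw.mul_left C).comp_injective hinj)
    (fun k x _ => hasWirtingerAt_zwegersTerm hτ x _) (fun k x hx => ?_) (fun k x hx => ?_)
    ((summable_zwegersTerm hτ v).comp_injective hinj)⟩
  · refine ((norm_sub_le _ _).trans (add_le_add (norm_zwegersTerm_mul_le hτ x _)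
      (norm_dbarFactor_mul_conj_thetaExp_le hτ x _))).trans ?_
    rw [← add_mul]
    exact hle _ x hx
  · refine (norm_dbarFactor_mul_conj_thetaExp_le hτ x _).trans (le_trans ?_ (hle _ x hx))
    gcongr
    exact le_add_of_nonneg_left (by positivity)

end ZwegersDerivative

section FiniteFourier

variable {N : ℕ} [NeZero N]

theorem sum_range_e_mul_div (k : ℤ) :
    ∑ j ∈ Finset.range N, e (j * (k / N)) = if (N : ℤ) ∣ k then (N : ℂ) else 0 := by
  have hN : (N : ℂ) ≠ 0 := NeZero.ne _
  simp only [e_natCast_mul]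
  split_ifs with hdvd
  · obtain ⟨m, rfl⟩ := hdvd
    simp [hN, e_intCast]
  · have hne : e (k / N) ≠ 1 := fun h => hdvd <| by
      obtain ⟨m, hm⟩ := e_eq_one_iff.mp h
      rw [div_eq_iff hN] at hm
      exact ⟨m, by rw [mul_comm]; exact_mod_cast hm⟩
    rw [geom_sum_eq hne, ← e_natCast_mul, mul_div_cancel₀ _ hN, e_intCast, sub_self, zero_div]

theorem sum_range_conj_fourier_mul_fourier (a b : ℕ → ℂ) :
    ∑ j ∈ Finset.range N, conj (∑ l ∈ Finset.range N, e (-(j * l / N)) * a l) *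
        ∑ l ∈ Finset.range N, e (-(j * l / N)) * b l =
      N * ∑ l ∈ Finset.range N, conj (a l) * b l := by
  have hphase (j l l' : ℕ) : conj (e (-(j * l / N)) * a l) * (e (-(j * l' / N)) * b l') =
      conj (a l) * b l' * e (j * (((l - l' : ℤ) : ℂ) / N)) := by
    rw [map_mul, conj_e, mul_mul_mul_comm, ← e_add, mul_comm]
    simp only [map_neg, map_div₀, map_mul, map_natCast]
    push_cast
    ring_nf
  have horth (l l' : ℕ) (hl : l ∈ Finset.range N) (hl' : l' ∈ Finset.range N) :
      ∑ j ∈ Finset.range N, e (j * (((l - l' : ℤ) : ℂ) / N)) = if l = l' then (N : ℂ) else 0 := by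
    rw [sum_range_e_mul_div]
    refine if_congr ⟨fun hdvd => ?_, fun h => by simp [h]⟩ rfl rfl
    have := Int.eq_zero_of_abs_lt_dvd hdvd
      (by rw [abs_lt]; constructor <;> linarith [Finset.mem_range.mp hl, Finset.mem_range.mp hl'])
    omega
  simp only [map_sum, Finset.sum_mul_sum, hphase]
  rw [Finset.sum_comm, Finset.mul_sum]
  refine Finset.sum_congr rfl fun l hl => ?_
  rw [Finset.sum_comm]
  calc ∑ l' ∈ Finset.range N, ∑ j ∈ Finset.range N,
        conj (a l) * b l' * e (j * (((l - l' : ℤ) : ℂ) / N))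
      = ∑ l' ∈ Finset.range N, conj (a l) * b l' * if l = l' then (N : ℂ) else 0 :=
        Finset.sum_congr rfl fun l' hl' => by rw [← Finset.mul_sum, horth l l' hl hl']
    _ = N * (conj (a l) * b l) := by
        rw [Finset.sum_eq_single_of_mem l hl fun l' _ h => by rw [if_neg h.symm, mul_zero],
          if_pos rfl, mul_comm]

end FiniteFourier

section ThetaInversion

variable {M : ℕ} [NeZero M] {τ : ℂ}

theorem Theta_two_mul_eq_jacobiTheta₂ (j : ℤ) (v : ℂ) :
    Theta j M τ (2 * v) =
      thetaExp M τ v j * jacobiTheta₂ (2 * M * v + j * τ) (2 * M * τ) := by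
  have hM : (M : ℂ) ≠ 0 := NeZero.ne _
  rw [Theta_two_mul, jacobiTheta₂, ← tsum_mul_left]
  refine tsum_congr fun k => ?_
  rw [thetaExp_eq_jacobiTheta₂_term, thetaExp_eq_jacobiTheta₂_term]
  simp only [jacobiTheta₂_term]
  rw [← Complex.exp_add]
  congr 1
  push_cast
  field_simp
  ring

theorem jacobiTheta₂_eq_sum_Theta (hτ : 0 < τ.im) (j : ℤ) (v : ℂ) :
    jacobiTheta₂ (v - j / (2 * M)) (τ / (2 * M)) =
      ∑ l ∈ Finset.range (2 * M), e (-(j * l / (2 * M))) * Theta l M τ (2 * v) := by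
  have hM : (M : ℂ) ≠ 0 := NeZero.ne _
  simp only [jacobiTheta₂, ← thetaExp_eq_jacobiTheta₂_term]
  rw [tsum_int_eq_sum_range_tsum (2 * M) (summable_thetaExp hτ _)]
  refine Finset.sum_congr rfl fun l _ => ?_
  rw [Theta_two_mul, ← tsum_mul_left]
  refine tsum_congr fun k => ?_
  rw [thetaExp, thetaExp, ← e_add]
  refine e_eq_e_of_eq_add_intCast (-(j * k)) ?_
  push_cast
  field_simp
  ring

theorem ne_zero_of_im_pos (hτ : 0 < τ.im) : τ ≠ 0 := by
  rintro rfl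
  simp at hτ

theorem Theta_neg_one_div (hτ : 0 < τ.im) (j : ℤ) (v : ℂ) :
    Theta j M (-1 / τ) (2 * (v / τ)) = (-I * (τ / (2 * M))) ^ (1 / 2 : ℂ) * e (M * v ^ 2 / τ) *
      ∑ l ∈ Finset.range (2 * M), e (-(j * l / (2 * M))) * Theta l M τ (2 * v) := by
  have hM : (M : ℂ) ≠ 0 := NeZero.ne _
  have := ne_zero_of_im_pos hτ
  have harg : (v - j / (2 * M)) / (τ / (2 * M)) = 2 * M * (v / τ) + j * (-1 / τ) := by
    field_simp
    ring
  have hperiod : -1 / (τ / (2 * M)) = 2 * M * (-1 / τ) := by field_simp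
  have hexp : thetaExp M (-1 / τ) (v / τ) j =
      e (M * v ^ 2 / τ) * cexp (-π * I * (v - j / (2 * M)) ^ 2 / (τ / (2 * M))) := by
    rw [thetaExp, e, e, ← Complex.exp_add]
    congr 1
    field_simp
    ring
  rw [← jacobiTheta₂_eq_sum_Theta hτ, jacobiTheta₂_functional_equation,
    Theta_two_mul_eq_jacobiTheta₂, harg, hperiod, hexp]
  field_simp

/-- The kernel `∑_j conj Θ_{j,M}(τ, 2v) Θ_{j,M}(τ, 2u)`, to which the `v̄`-derivative of the
correction of an Appell sum is proportional. -/
def thetaKernel (M : ℕ) (τ u v : ℂ) : ℂ :=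
  ∑ j ∈ Finset.range (2 * M), conj (Theta j M τ (2 * v)) * Theta j M τ (2 * u)

theorem conj_cpow_half_mul_self (x : ℂ) : conj (x ^ (1 / 2 : ℂ)) * x ^ (1 / 2 : ℂ) = ‖x‖ := by
  rw [Complex.conj_mul', ← Complex.ofReal_pow, ← norm_pow, ← Complex.cpow_nat_mul]
  norm_num

/-- The matrix of the inversion acts on theta functions as a finite Fourier transform, hence
unitarily up to a scalar. -/
theorem thetaKernel_neg_one_div (hτ : 0 < τ.im) (u v : ℂ) :
    thetaKernel M (-1 / τ) (u / τ) (v / τ) =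
      ‖τ‖ * conj (e (M * v ^ 2 / τ)) * e (M * u ^ 2 / τ) * thetaKernel M τ u v := by
  have hM : (M : ℂ) ≠ 0 := NeZero.ne _
  set c : ℂ := (-I * (τ / (2 * M))) ^ (1 / 2 : ℂ)
  have hc : conj c * c * (2 * M) = ‖τ‖ := by
    rw [conj_cpow_half_mul_self]
    simp
    field_simp
  have hparseval := sum_range_conj_fourier_mul_fourier (N := 2 * M)
    (fun l => Theta l M τ (2 * v)) fun l => Theta l M τ (2 * u)
  simp only [Nat.cast_mul, Nat.cast_ofNat] at hparseval
  have hinversion (w : ℂ) (j : ℕ) : Theta j M (-1 / τ) (2 * (w / τ)) = c * e (M * w ^ 2 / τ) *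
      ∑ l ∈ Finset.range (2 * M), e (-(j * l / (2 * M))) * Theta l M τ (2 * w) := by
    simpa only [Int.cast_natCast] using Theta_neg_one_div (M := M) hτ j w
  have hfactor (A B S T : ℂ) :
      conj (c * A * S) * (c * B * T) = conj c * c * conj A * B * (conj S * T) := by
    simp only [map_mul]
    ring
  simp only [thetaKernel, hinversion, hfactor]
  rw [← Finset.mul_sum, hparseval, ← hc]
  ring

end ThetaInversion

section Lattice

variable {τ w : ℂ}

/-- `w` does not lie in the lattice `ℤ + ℤτ`. -/
def OffLattice (τ w : ℂ) : Prop := ∀ j k : ℤ, w ≠ j + k * τ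

theorem offLattice_iff_e_ne_one : OffLattice τ w ↔ ∀ n : ℤ, e (w + n * τ) ≠ 1 := by
  simp only [OffLattice, Ne, e_eq_one_iff, not_exists]
  refine ⟨fun h n k hk => h k (-n) ?_, fun h j k hjk => h (-k) j ?_⟩
  · rw [eq_sub_of_add_eq hk]
    push_cast
    ring
  · rw [hjk]
    push_cast
    ring

theorem OffLattice.neg (h : OffLattice τ w) : OffLattice τ (-w) := fun j k hjk =>
  h (-j) (-k) <| by
    rw [← neg_neg w, hjk]
    push_cast
    ring

theorem OffLattice.add (h : OffLattice τ w) (a b : ℤ) : OffLattice τ (w + (a + b * τ)) :=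
  fun j k hjk => h (j - a) (k - b) <| by
    rw [eq_sub_of_add_eq hjk]
    push_cast
    ring

theorem OffLattice.sub_add {u v : ℂ} (h : OffLattice τ (u - v)) (a b : ℤ) :
    OffLattice τ (u - (v + (a + b * τ))) := by
  convert h.add (-a) (-b) using 1
  push_cast
  ring

theorem e_intCast_mul_ne_one (hτ : 0 < τ.im) {n : ℤ} (hn : n ≠ 0) : e (n * τ) ≠ 1 := by
  rw [Ne, e_eq_one_iff]
  rintro ⟨k, hk⟩
  have him := congrArg Complex.im hk
  simp [hn, hτ.ne'] at him

theorem half_le_norm_one_sub_e (hw : 1 ≤ |w.im|) : 1 / 2 ≤ ‖1 - e w‖ := by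
  have hexp : 2 ≤ Real.exp (2 * π) := by linarith [Real.add_one_le_exp (2 * π), Real.pi_gt_three]
  rcases le_abs'.mp hw with h | h
  · have hlarge : 2 ≤ ‖e w‖ := by
      rw [norm_e]
      exact hexp.trans (Real.exp_le_exp.mpr (by nlinarith [Real.pi_pos]))
    have := norm_sub_norm_le (e w) 1
    rw [norm_one, norm_sub_rev] at this
    linarith
  · have hsmall : ‖e w‖ ≤ 1 / 2 := by
      rw [norm_e, one_div, ← neg_neg (-2 * π * w.im), Real.exp_neg]
      exact inv_anti₀ two_pos (hexp.trans (Real.exp_le_exp.mpr (by nlinarith [Real.pi_pos])))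
    have := norm_sub_norm_le 1 (e w)
    rw [norm_one] at this
    linarith

theorem one_le_abs_im_add_intCast_mul (hτ : 0 < τ.im) {w₀ : ℂ} (hw : ‖w - w₀‖ < 1) {n : ℤ}
    (hn : (|w₀.im| + 2) / τ.im ≤ |(n : ℝ)|) : 1 ≤ |(w + n * τ).im| := by
  rw [div_le_iff₀ hτ, ← abs_of_pos hτ, ← abs_mul] at hn
  have hdist := (Complex.abs_im_le_norm (w - w₀)).trans_lt hw
  rw [Complex.sub_im] at hdist
  have him : (w + n * τ).im = n * τ.im + (w₀.im + (w.im - w₀.im)) := by simp; ring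
  rw [him]
  linarith [abs_add_le w₀.im (w.im - w₀.im),
    abs_sub_abs_le_abs_add (n * τ.im) (w₀.im + (w.im - w₀.im))]

theorem exists_pos_eventually_forall_le {X ι : Type*} [TopologicalSpace X] {x₀ : X}
    {g : ι → X → ℝ} (F : Finset ι) (hcont : ∀ i ∈ F, ContinuousAt (g i) x₀)
    (hpos : ∀ i ∈ F, 0 < g i x₀) : ∃ δ > 0, ∀ᶠ x in 𝓝 x₀, ∀ i ∈ F, δ ≤ g i x := by
  have hsmall : ∀ᶠ δ in 𝓝[>] (0 : ℝ), ∀ i ∈ F, δ < g i x₀ :=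
    (eventually_all_finset F).mpr fun i hi =>
      (eventually_lt_nhds (hpos i hi)).filter_mono nhdsWithin_le_nhds
  obtain ⟨δ, hlt, hδ⟩ := (hsmall.and self_mem_nhdsWithin).exists
  exact ⟨δ, hδ, (eventually_all_finset F).mpr fun i hi =>
    ((hcont i hi).eventually_const_lt (hlt i hi)).mono fun _ => le_of_lt⟩

theorem eventually_le_norm_one_sub_e (hτ : 0 < τ.im) {s : Set ℤ} {w₀ : ℂ}
    (hs : ∀ n ∈ s, e (w₀ + n * τ) ≠ 1) :
    ∃ δ > 0, ∀ᶠ w in 𝓝 w₀, ∀ n ∈ s, δ ≤ ‖1 - e (w + n * τ)‖ := by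
  classical
  obtain ⟨N, hN⟩ := exists_nat_ge ((|w₀.im| + 2) / τ.im)
  obtain ⟨δ, hδ, hnear⟩ := exists_pos_eventually_forall_le
    (g := fun (n : ℤ) w => ‖1 - e (w + n * τ)‖) ((Finset.Icc (-N : ℤ) N).filter (· ∈ s))
    (fun n _ => by fun_prop)
    fun n hn => norm_pos_iff.mpr (sub_ne_zero.mpr (hs n (Finset.mem_filter.mp hn).2).symm)
  refine ⟨min δ (1 / 2), lt_min hδ (by norm_num), ?_⟩
  filter_upwards [hnear, Metric.ball_mem_nhds w₀ one_pos] with w hw hball n hn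
  by_cases hnN : n ∈ Finset.Icc (-N : ℤ) N
  · exact (min_le_left _ _).trans (hw n (Finset.mem_filter.mpr ⟨hnN, hn⟩))
  · refine (min_le_right _ _).trans (half_le_norm_one_sub_e
      (one_le_abs_im_add_intCast_mul hτ (mem_ball_iff_norm.mp hball) (hN.trans ?_)))
    rw [Finset.mem_Icc, ← abs_le, not_le] at hnN
    exact_mod_cast hnN.le

theorem eventually_offLattice (hτ : 0 < τ.im) (w₀ : ℂ) : ∀ᶠ w in 𝓝[≠] w₀, OffLattice τ w := by
  obtain ⟨δ, hδ, hfar⟩ := eventually_le_norm_one_sub_e hτ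
    (s := {n | e (w₀ + n * τ) ≠ 1}) fun n hn => hn
  have hne : ∀ᶠ w in 𝓝[≠] w₀, e (w - w₀) ≠ 1 :=
    ((hasDerivAt_e (w₀ - w₀)).comp_sub_const w₀ w₀).eventually_ne (by simp [e_zero])
  filter_upwards [hfar.filter_mono nhdsWithin_le_nhds, hne] with w hw hww₀
  refine offLattice_iff_e_ne_one.mpr fun n hn => ?_
  by_cases hs : e (w₀ + n * τ) = 1
  · refine hww₀ ?_
    rw [← add_sub_add_right_eq_sub w w₀ (n * τ), sub_eq_add_neg, e_add, e_neg, hs, hn]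
    simp
  · have := hw n hs
    rw [hn, sub_self, norm_zero] at this
    linarith

end Lattice

section AppellSums

variable {M : ℕ} {τ : ℂ} {c : ℤ → ℂ} {w : ℂ}

theorem norm_div_le_mul_inv {a b : ℂ} {δ : ℝ} (hδ : 0 < δ) (hb : δ ≤ ‖b‖) :
    ‖a / b‖ ≤ ‖a‖ * δ⁻¹ := by
  rw [norm_div, div_eq_mul_inv]
  gcongr

theorem summable_div_one_sub_e (hτ : 0 < τ.im) (hc : Summable c) (hw : OffLattice τ w) :
    Summable fun n : ℤ => c n / (1 - e (w + n * τ)) := by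
  obtain ⟨δ, hδ, h⟩ := eventually_le_norm_one_sub_e hτ (s := Set.univ)
    fun n _ => offLattice_iff_e_ne_one.mp hw n
  exact .of_norm_bounded (hc.norm.mul_right δ⁻¹)
    fun n => norm_div_le_mul_inv hδ (h.self_of_nhds n trivial)

theorem differentiableAt_tsum_div_one_sub_e (hτ : 0 < τ.im) (hc : Summable c)
    (hw : OffLattice τ w) :
    DifferentiableAt ℂ (fun x => ∑' n : ℤ, c n / (1 - e (x + n * τ))) w := by
  obtain ⟨δ, hδ, h⟩ := eventually_le_norm_one_sub_e hτ (s := Set.univ)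
    fun n _ => offLattice_iff_e_ne_one.mp hw n
  obtain ⟨ε, hε, hball⟩ := Metric.eventually_nhds_iff_ball.mp h
  have hterm (n : ℤ) : DifferentiableOn ℂ (fun x => c n / (1 - e (x + n * τ)))
      (Metric.ball w ε) := fun x hx => by
    have hne : 1 - e (x + n * τ) ≠ 0 := norm_pos_iff.mp (hδ.trans_le (hball x hx n trivial))
    fun_prop (disch := exact hne)
  exact (differentiableOn_tsum_of_summable_norm (hc.norm.mul_right δ⁻¹) hterm
    Metric.isOpen_ball fun n x hx =>
      norm_div_le_mul_inv hδ (hball x hx n trivial)).differentiableAt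
    (Metric.ball_mem_nhds w hε)

theorem tendsto_div_one_sub_e :
    Tendsto (fun w : ℂ => w / (1 - e w)) (𝓝[≠] 0) (𝓝 (-(2 * π * I)⁻¹)) := by
  have hslope := (hasDerivAt_e 0).tendsto_slope_zero
  rw [e_zero, mul_one] at hslope
  refine (hslope.inv₀ Complex.two_pi_I_ne_zero).neg.congr fun w => ?_
  rw [zero_add, smul_eq_mul, mul_inv, inv_inv, ← neg_sub (e w) 1, div_neg, div_eq_mul_inv]

theorem tendsto_mul_div_one_sub_e_of_ne_zero (hτ : 0 < τ.im) {n : ℤ} (hn : n ≠ 0) (a : ℂ) :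
    Tendsto (fun w : ℂ => w * (a / (1 - e (w + n * τ)))) (𝓝[≠] 0) (𝓝 0) := by
  have hne : 1 - e (0 + n * τ) ≠ 0 := by
    rw [zero_add]
    exact sub_ne_zero.mpr (e_intCast_mul_ne_one hτ hn).symm
  have hcont : ContinuousAt (fun w : ℂ => w * (a / (1 - e (w + n * τ)))) 0 := by
    fun_prop (disch := exact hne)
  simpa using hcont.tendsto.mono_left nhdsWithin_le_nhds

theorem tendsto_mul_tsum_div_one_sub_e (hτ : 0 < τ.im) (hc : Summable c) :
    Tendsto (fun w => w * ∑' n : ℤ, c n / (1 - e (w + n * τ))) (𝓝[≠] 0)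
      (𝓝 (-(2 * π * I)⁻¹ * c 0)) := by
  obtain ⟨δ, hδ, hfar⟩ := eventually_le_norm_one_sub_e hτ (s := {0}ᶜ) (w₀ := 0)
    fun n hn => by simpa using e_intCast_mul_ne_one hτ hn
  have hzero : ∀ᶠ w in 𝓝[≠] (0 : ℂ), ‖w / (1 - e w)‖ < ‖-(2 * π * I)⁻¹‖ + 1 :=
    tendsto_div_one_sub_e.norm.eventually_lt_const (lt_add_one _)
  rw [← tsum_ite_eq (0 : ℤ) fun _ => -(2 * π * I)⁻¹ * c 0]
  simp only [← tsum_mul_left]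
  refine tendsto_tsum_of_dominated_convergence
    (hc.norm.mul_left (‖-(2 * π * I)⁻¹‖ + 1 + δ⁻¹)) (fun n => ?_) ?_
  · split_ifs with hn
    · subst hn
      exact (tendsto_div_one_sub_e.mul_const (c 0)).congr fun w => by simp; ring
    · exact tendsto_mul_div_one_sub_e_of_ne_zero hτ hn (c n)
  · filter_upwards [hzero, hfar.filter_mono nhdsWithin_le_nhds,
      nhdsWithin_le_nhds (Metric.ball_mem_nhds (0 : ℂ) one_pos)] with w h0 hw hball n
    rw [mul_div_left_comm, norm_mul, mul_comm]
    gcongr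
    rcases eq_or_ne n 0 with rfl | hn
    · simpa using h0.le.trans (le_add_of_nonneg_right (inv_pos.mpr hδ).le)
    · refine (norm_div_le_mul_inv hδ (hw n hn)).trans ?_
      have : ‖w‖ * δ⁻¹ ≤ δ⁻¹ := mul_le_of_le_one_left (by positivity)
        (mem_ball_zero_iff.mp hball).le
      linarith [norm_nonneg (-(2 * π * I)⁻¹)]

/-- The level `M` Appell sum `∑_n q^{M n²} e^{4πi M n u} / (1 - e^{2πi(u - v)} q^n)`. -/
def appell (M : ℕ) (τ u v : ℂ) : ℂ :=
  ∑' n : ℤ, thetaExp M τ u (2 * M * n) / (1 - e (u - v + n * τ))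

variable {u v : ℂ}

theorem summable_thetaExp_two_mul_mul [NeZero M] (hτ : 0 < τ.im) (u : ℂ) :
    Summable fun n : ℤ => thetaExp M τ u (2 * M * n) :=
  (summable_thetaExp hτ u).comp_injective fun n n' h => by simpa [NeZero.ne M] using h

theorem summable_appell [NeZero M] (hτ : 0 < τ.im) (h : OffLattice τ (u - v)) :
    Summable fun n : ℤ => thetaExp M τ u (2 * M * n) / (1 - e (u - v + n * τ)) :=
  summable_div_one_sub_e hτ (summable_thetaExp_two_mul_mul hτ u) h

theorem differentiableAt_appell [NeZero M] (hτ : 0 < τ.im) (h : OffLattice τ (u - v)) :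
    DifferentiableAt ℂ (fun v => appell M τ u v) v :=
  (differentiableAt_tsum_div_one_sub_e hτ (summable_thetaExp_two_mul_mul hτ u) h).comp v
    (differentiableAt_id.const_sub u)

theorem tendsto_const_sub_punctured_nhds (u v : ℂ) :
    Tendsto (fun x => u - x) (𝓝[≠] v) (𝓝[≠] (u - v)) :=
  ((Homeomorph.subLeft u).map_punctured_nhds_eq v).le

theorem tendsto_mul_appell [NeZero M] (hτ : 0 < τ.im) (u : ℂ) :
    Tendsto (fun v => (v - u) * appell M τ u v) (𝓝[≠] u) (𝓝 (2 * π * I)⁻¹) := by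
  have hsub := tendsto_const_sub_punctured_nhds u u
  rw [sub_self] at hsub
  have hlim := ((tendsto_mul_tsum_div_one_sub_e hτ
    (summable_thetaExp_two_mul_mul (M := M) hτ u)).comp hsub).neg
  have hnum : thetaExp M τ u (2 * M * 0) = 1 := by simp [thetaExp, e_zero]
  rw [hnum, mul_one, neg_neg] at hlim
  refine hlim.congr fun v => ?_
  rw [Function.comp_apply, appell, ← neg_mul, neg_sub]

end AppellSums

section NegativeIndex

variable {M : ℕ} {τ u : ℂ}

theorem differentiable_limUnder_of_tendsto_sub_mul {f : ℂ → ℂ}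
    (hd : ∀ c, ∀ᶠ v in 𝓝[≠] c, DifferentiableAt ℂ f v)
    (hf : ∀ c, Tendsto (fun v => (v - c) * f v) (𝓝[≠] c) (𝓝 0)) :
    Differentiable ℂ fun c => limUnder (𝓝[≠] c) f := by
  intro c
  have hlittle : (fun v => f v - f c) =o[𝓝[≠] c] fun v => (v - c)⁻¹ := by
    refine (Asymptotics.isLittleO_iff_tendsto' ?_).mpr ?_
    · filter_upwards [self_mem_nhdsWithin] with v hv h0
      exact absurd (sub_eq_zero.mp (inv_eq_zero.mp h0)) hv
    · have hconst : Tendsto (fun v : ℂ => (v - c) * f c) (𝓝[≠] c) (𝓝 0) :=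
        ((by fun_prop : Continuous fun v : ℂ => (v - c) * f c).tendsto' c 0 (by simp)).mono_left
          nhdsWithin_le_nhds
      simpa [mul_comm, mul_sub] using (hf c).sub hconst
  have hmem : {v | v ≠ c → DifferentiableAt ℂ f v} ∈ 𝓝 c :=
    eventually_nhdsWithin_iff.mp (hd c)
  refine (((Complex.differentiableOn_update_limUnder_of_isLittleO hmem
    (fun v hv => (hv.1 hv.2).differentiableWithinAt) hlittle).differentiableAt
    hmem)).congr_of_eventuallyEq ?_
  filter_upwards [hmem] with v hv
  rcases eq_or_ne v c with rfl | hvc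
  · rw [Function.update_self]
  · rw [Function.update_of_ne hvc]
    exact ((hv hvc).continuousAt.tendsto.mono_left nhdsWithin_le_nhds).limUnder_eq

theorem bddAbove_range_of_periodic (hτ : 0 < τ.im) {g : ℂ → ℝ} (hg : Continuous g)
    (hone : g.Periodic 1) (hperiod : g.Periodic τ) : BddAbove (Set.range g) := by
  have hcell : Continuous fun p : ℝ × ℝ => g (p.1 + p.2 * τ) := by fun_prop
  refine ((isCompact_Icc (a := (0 : ℝ × ℝ)) (b := 1)).bddAbove_image hcell.continuousOn).mono ?_
  rintro _ ⟨v, rfl⟩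
  set α : ℝ := v.im / τ.im
  set β : ℝ := (v - α * τ).re
  have hv : v = β + α * τ := by
    apply Complex.ext
    · simp [β]
    · simp [α, hτ.ne']
  refine ⟨(Int.fract β, Int.fract α), ⟨⟨Int.fract_nonneg _, Int.fract_nonneg _⟩,
    (Int.fract_lt_one _).le, (Int.fract_lt_one _).le⟩, ?_⟩
  have hshift : v = (Int.fract β : ℝ) + (Int.fract α : ℝ) * τ + ⌊β⌋ * 1 + ⌊α⌋ * τ := by
    conv_lhs => rw [hv, ← Int.fract_add_floor β, ← Int.fract_add_floor α]
    push_cast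
    ring
  conv_rhs => rw [hshift, hperiod.int_mul, hone.int_mul]

/-- The Gaussian weight `e^{2πM (Im v)²/Im τ}`, which makes the norm of a quasi-periodic function
of index `-M` doubly periodic. -/
def gaussWeight (M : ℕ) (τ v : ℂ) : ℝ := Real.exp (2 * π * M * v.im ^ 2 / τ.im)

theorem gaussWeight_add_one (v : ℂ) : gaussWeight M τ (v + 1) = gaussWeight M τ v := by
  simp [gaussWeight]

theorem norm_e_mul_gaussWeight_add (hτ : 0 < τ.im) (v : ℂ) :
    ‖e (M * (2 * v + τ))‖ * gaussWeight M τ (v + τ) = gaussWeight M τ v := by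
  have him : (M * (2 * v + τ)).im = M * (2 * v.im + τ.im) := by simp
  rw [gaussWeight, gaussWeight, norm_e, him, ← Real.exp_add, Complex.add_im]
  congr 1
  field_simp
  ring

theorem one_le_gaussWeight (hτ : 0 < τ.im) (v : ℂ) : 1 ≤ gaussWeight M τ v :=
  Real.one_le_exp (by positivity)

theorem eq_zero_of_differentiable_of_quasiperiodic [NeZero M] (hτ : 0 < τ.im) {f : ℂ → ℂ}
    (hd : Differentiable ℂ f) (hone : ∀ v, f (v + 1) = f v)
    (hperiod : ∀ v, f (v + τ) = e (M * (2 * v + τ)) * f v) : f = 0 := by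
  have hcont : Continuous fun v => ‖f v‖ * gaussWeight M τ v := by
    have := hd.continuous
    unfold gaussWeight
    fun_prop
  obtain ⟨C, hC⟩ := bddAbove_range_of_periodic hτ hcont
    (fun v => by simp only [hone, gaussWeight_add_one])
    fun v => by
      simp only [hperiod, norm_mul]
      rw [mul_comm ‖e _‖, mul_assoc, norm_e_mul_gaussWeight_add hτ]
  have hbdd : Bornology.IsBounded (Set.range f) := isBounded_iff_forall_norm_le.mpr ⟨C, by
    rintro _ ⟨v, rfl⟩
    exact (le_mul_of_one_le_right (norm_nonneg _) (one_le_gaussWeight hτ v)).trans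
      (hC (Set.mem_range_self v))⟩
  have hconst (v : ℂ) : f v = f 0 := hd.apply_eq_apply_of_bounded hbdd v 0
  have hmultiplier : e (M * τ) ≠ 1 := by
    simpa using e_intCast_mul_ne_one hτ (Nat.cast_ne_zero.mpr (NeZero.ne M))
  have hzero : f 0 = 0 := by
    have h0 := hperiod 0
    rw [hconst, mul_zero, zero_add] at h0
    by_contra hne
    exact hmultiplier ((mul_eq_right₀ hne).mp h0.symm)
  exact funext fun v => (hconst v).trans hzero

theorem tendsto_norm_sub_mul_of_periodic (hτ : 0 < τ.im) {g : ℂ → ℝ} {t : ℂ}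
    (hg : ∀ v, OffLattice τ (u - v) → g (v + t) = g v) :
    Function.Periodic (fun c => Tendsto (fun v => ‖v - c‖ * g v) (𝓝[≠] c) (𝓝 0)) t := by
  intro c
  have hmap : 𝓝[≠] (c + t) = map (· + t) (𝓝[≠] c) :=
    ((Homeomorph.addRight t).map_punctured_nhds_eq c).symm
  dsimp only
  rw [hmap, tendsto_map'_iff]
  refine propext (tendsto_congr' ?_)
  filter_upwards [(tendsto_const_sub_punctured_nhds u c).eventually
    (eventually_offLattice hτ _)] with v hv
  rw [Function.comp_apply, hg v hv, add_sub_add_right_eq_sub]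

theorem norm_mul_gaussWeight_add_one {f : ℂ → ℂ} {v : ℂ} (hf : f (v + 1) = f v) :
    ‖f (v + 1)‖ * gaussWeight M τ (v + 1) = ‖f v‖ * gaussWeight M τ v := by
  rw [hf, gaussWeight_add_one]

theorem norm_mul_gaussWeight_add_tau (hτ : 0 < τ.im) {f : ℂ → ℂ} {v : ℂ}
    (hf : f (v + τ) = e (M * (2 * v + τ)) * f v) :
    ‖f (v + τ)‖ * gaussWeight M τ (v + τ) = ‖f v‖ * gaussWeight M τ v := by
  rw [hf, norm_mul, mul_comm ‖e _‖, mul_assoc, norm_e_mul_gaussWeight_add hτ]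

theorem tendsto_sub_mul_of_quasiperiodic (hτ : 0 < τ.im) {f : ℂ → ℂ}
    (hd : ∀ v, OffLattice τ (u - v) → DifferentiableAt ℂ f v)
    (hres : Tendsto (fun v => (v - u) * f v) (𝓝[≠] u) (𝓝 0))
    (hone : ∀ v, OffLattice τ (u - v) → f (v + 1) = f v)
    (hperiod : ∀ v, OffLattice τ (u - v) → f (v + τ) = e (M * (2 * v + τ)) * f v) (c : ℂ) :
    Tendsto (fun v => (v - c) * f v) (𝓝[≠] c) (𝓝 0) := by
  by_cases hc : OffLattice τ (u - c)
  · have hcont : ContinuousAt (fun v => (v - c) * f v) c := by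
      have := (hd c hc).continuousAt
      fun_prop
    simpa using hcont.tendsto.mono_left nhdsWithin_le_nhds
  have hweight : Continuous (gaussWeight M τ) := by
    unfold gaussWeight
    fun_prop
  obtain ⟨a, b, hab⟩ : ∃ a b : ℤ, u - c = a + b * τ := by simpa [OffLattice] using hc
  have hu : Tendsto (fun v => ‖v - u‖ * (‖f v‖ * gaussWeight M τ v)) (𝓝[≠] u) (𝓝 0) := by
    simpa [← mul_assoc] using
      hres.norm.mul ((hweight.tendsto u).mono_left nhdsWithin_le_nhds)
  have hone' := tendsto_norm_sub_mul_of_periodic hτ (g := fun v => ‖f v‖ * gaussWeight M τ v)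
    fun v hv => norm_mul_gaussWeight_add_one (hone v hv)
  have hperiod' := tendsto_norm_sub_mul_of_periodic hτ (g := fun v => ‖f v‖ * gaussWeight M τ v)
    fun v hv => norm_mul_gaussWeight_add_tau hτ (hperiod v hv)
  have hc' : Tendsto (fun v => ‖v - c‖ * (‖f v‖ * gaussWeight M τ v)) (𝓝[≠] c) (𝓝 0) := by
    rw [show u = c + a * 1 + b * τ by linear_combination hab] at hu
    exact (hone'.int_mul a c).mp ((hperiod'.int_mul b _).mp hu)
  refine squeeze_zero_norm (fun v => ?_) hc'
  rw [norm_mul]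
  gcongr
  exact le_mul_of_one_le_right (norm_nonneg _) (one_le_gaussWeight hτ v)

theorem eq_zero_of_quasiperiodic [NeZero M] (hτ : 0 < τ.im) {f : ℂ → ℂ}
    (hd : ∀ v, OffLattice τ (u - v) → DifferentiableAt ℂ f v)
    (hres : Tendsto (fun v => (v - u) * f v) (𝓝[≠] u) (𝓝 0))
    (hone : ∀ v, OffLattice τ (u - v) → f (v + 1) = f v)
    (hperiod : ∀ v, OffLattice τ (u - v) → f (v + τ) = e (M * (2 * v + τ)) * f v)
    {v : ℂ} (hv : OffLattice τ (u - v)) : f v = 0 := by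
  set F : ℂ → ℂ := fun c => limUnder (𝓝[≠] c) f
  have hoff (c : ℂ) : ∀ᶠ v in 𝓝[≠] c, OffLattice τ (u - v) :=
    (tendsto_const_sub_punctured_nhds u c).eventually (eventually_offLattice hτ _)
  have hF : Differentiable ℂ F := differentiable_limUnder_of_tendsto_sub_mul
    (fun c => (hoff c).mono fun v hv => hd v hv)
    (tendsto_sub_mul_of_quasiperiodic hτ hd hres hone hperiod)
  have hFf (v : ℂ) (hv : OffLattice τ (u - v)) : F v = f v :=
    ((hd v hv).continuousAt.tendsto.mono_left nhdsWithin_le_nhds).limUnder_eq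
  have hext {t : ℂ} (ht : ∀ v, OffLattice τ (u - v) → OffLattice τ (u - (v + t))) {m : ℂ → ℂ}
      (hm : Continuous m) (hf : ∀ v, OffLattice τ (u - v) → f (v + t) = m v * f v) (c : ℂ) :
      F (c + t) = m c * F c := by
    have hcont := hF.continuous
    refine (((ContinuousAt.eventuallyEq_nhds_iff_eventuallyEq_nhdsNE
      (f := fun v => F (v + t)) (g := fun v => m v * F v) (x := c) (by fun_prop)
      (by fun_prop)).mp ?_).eq_of_nhds)
    filter_upwards [hoff c] with v hv
    rw [hFf _ (ht v hv), hFf _ hv, hf v hv]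
  have hFone (c : ℂ) : F (c + 1) = F c := by
    simpa only [one_mul] using hext (fun v hv => by simpa using hv.sub_add 1 0)
      (m := fun _ => 1) continuous_const (fun v hv => (hone v hv).trans (one_mul _).symm) c
  have hFperiod := hext (fun v hv => by simpa using hv.sub_add 0 1) (by fun_prop) hperiod
  rw [← hFf v hv, eq_zero_of_differentiable_of_quasiperiodic hτ hF hFone hFperiod, Pi.zero_apply]

end NegativeIndex

section EllipticTransformations

variable {M : ℕ} {τ u v : ℂ}

theorem thetaExp_neg_neg (v : ℂ) (n : ℤ) : thetaExp M τ (-v) (-n) = thetaExp M τ v n := by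
  rw [thetaExp, thetaExp]
  congr 1
  push_cast
  ring

theorem thetaExp_add_intCast_mul_half [NeZero M] (v : ℂ) (k n : ℤ) :
    thetaExp M τ (v + k * (τ / 2)) (n - k * M) =
      e (-(k * M * v + k ^ 2 * M * (τ / 4))) * thetaExp M τ v n := by
  have hM : (M : ℂ) ≠ 0 := NeZero.ne _
  rw [thetaExp, thetaExp, ← e_add]
  congr 1
  push_cast
  field_simp
  ring

theorem thetaExp_add (v w : ℂ) (n : ℤ) :
    thetaExp M τ (v + w) n = e (n * w) * thetaExp M τ v n := by
  rw [thetaExp, thetaExp, ← e_add]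
  ring_nf

theorem thetaExp_tau_add_one (v : ℂ) (n : ℤ) :
    thetaExp M (τ + 1) v n = e (n ^ 2 / (4 * M)) * thetaExp M τ v n := by
  rw [thetaExp, thetaExp, ← e_add]
  ring_nf

theorem Theta_periodic [NeZero M] (z : ℂ) :
    Function.Periodic (fun j : ℤ => Theta j M τ z) (2 * M) :=
  fun j => Theta_add_two_mul j M (NeZero.ne M) τ z

theorem Theta_neg_neg [NeZero M] (j : ℤ) (u : ℂ) :
    Theta (-j) M τ (2 * -u) = Theta j M τ (2 * u) := by
  rw [Theta_two_mul, Theta_two_mul, ← (Equiv.neg ℤ).tsum_eq]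
  refine tsum_congr fun k => ?_
  rw [← thetaExp_neg_neg u]
  congr 1
  simp only [Equiv.neg_apply]
  ring

theorem Theta_add_intCast_mul_half [NeZero M] (j : ℤ) (u : ℂ) (k : ℤ) :
    Theta (j - k * M) M τ (2 * (u + k * (τ / 2))) =
      e (-(k * M * u + k ^ 2 * M * (τ / 4))) * Theta j M τ (2 * u) := by
  rw [Theta_two_mul, Theta_two_mul, ← tsum_mul_left]
  refine tsum_congr fun n => ?_
  rw [← thetaExp_add_intCast_mul_half]
  congr 1
  ring

theorem Theta_add_intCast_mul_tau [NeZero M] (j : ℤ) (u : ℂ) (k : ℤ) :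
    Theta j M τ (2 * (u + k * τ)) =
      e (-(2 * k * M * u + k ^ 2 * M * τ)) * Theta j M τ (2 * u) := by
  have hshift := Theta_add_intCast_mul_half (M := M) (τ := τ) j u (2 * k)
  have hperiod := (Theta_periodic (M := M) (τ := τ) (2 * (u + k * τ))).sub_int_mul_eq (x := j) k
  rw [← hperiod]
  convert hshift using 3 <;> (push_cast; ring)

theorem Theta_add_intCast_div_two [NeZero M] (j : ℤ) (u : ℂ) (k : ℤ) :
    Theta j M τ (2 * (u + k / 2)) = e (j * (k / 2)) * Theta j M τ (2 * u) := by
  rw [Theta_two_mul, Theta_two_mul, ← tsum_mul_left]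
  refine tsum_congr fun n => ?_
  rw [thetaExp_add]
  congr 1
  refine e_eq_e_of_eq_add_intCast (M * n * k) ?_
  push_cast
  ring

theorem Theta_tau_add_one [NeZero M] (j : ℤ) (u : ℂ) :
    Theta j M (τ + 1) (2 * u) = e (j ^ 2 / (4 * M)) * Theta j M τ (2 * u) := by
  have hM : (M : ℂ) ≠ 0 := NeZero.ne _
  rw [Theta_two_mul, Theta_two_mul, ← tsum_mul_left]
  refine tsum_congr fun n => ?_
  rw [thetaExp_tau_add_one]
  congr 1
  refine e_eq_e_of_eq_add_intCast (j * n + M * n ^ 2) ?_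
  push_cast
  field_simp
  ring

theorem zwegersTerm_neg_neg (v : ℂ) (n : ℤ) :
    zwegersTerm M τ (-v) (-n) = (if n = 0 then 2 else 0) - zwegersTerm M τ v n := by
  have harg : zwegersArg M τ (-v) (-n) = -zwegersArg M τ v n := by
    simp only [zwegersArg, Complex.neg_im, Int.cast_neg]
    ring
  have hsign : Real.sign (((-n : ℤ) : ℝ) + 1 / 2) =
      (if n = 0 then 2 else 0) - Real.sign ((n : ℝ) + 1 / 2) := by
    rw [sign_intCast_add_half, sign_intCast_add_half]
    split_ifs <;> first | omega | norm_num
  rw [zwegersTerm_eq, zwegersTerm_eq, harg, thetaExp_neg_neg, hsign, E_neg]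
  split_ifs with hn
  · subst hn
    simp [thetaExp, e_zero]
    ring
  · push_cast
    ring

theorem zwegersTerm_add_half [NeZero M] (hτ : 0 < τ.im) (v : ℂ) (n : ℤ) :
    zwegersTerm M τ (v + τ / 2) (n - M) = e (M * v + M * (τ / 4)) *
      (zwegersTerm M τ v n - if 0 ≤ n ∧ n < M then 2 * (thetaExp M τ v n)⁻¹ else 0) := by
  have : (M : ℝ) ≠ 0 := NeZero.ne _
  have harg : zwegersArg M τ (v + τ / 2) (n - M) = zwegersArg M τ v n := by
    have him : (v + τ / 2).im = v.im + τ.im / 2 := by simp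
    simp only [zwegersArg, him]
    congr 1
    push_cast
    field_simp
    ring
  have hexp := thetaExp_add_intCast_mul_half (M := M) (τ := τ) v 1 n
  simp only [Int.cast_one, one_mul, one_pow] at hexp
  have hsign : Real.sign (((n - M : ℤ) : ℝ) + 1 / 2) =
      Real.sign ((n : ℝ) + 1 / 2) - if 0 ≤ n ∧ n < M then 2 else 0 := by
    rw [sign_intCast_add_half, sign_intCast_add_half]
    split_ifs <;> first | omega | norm_num
  rw [zwegersTerm_eq, zwegersTerm_eq, harg, hexp, hsign, e_neg, mul_inv, inv_inv]
  split_ifs <;> (push_cast; ring)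

theorem zwegersTerm_add_intCast_div_two (v : ℂ) (l n : ℤ) :
    zwegersTerm M τ (v + l / 2) n = (e (n * (l / 2)))⁻¹ * zwegersTerm M τ v n := by
  have harg : zwegersArg M τ (v + l / 2) n = zwegersArg M τ v n := by simp [zwegersArg]
  rw [zwegersTerm_eq, zwegersTerm_eq, harg, thetaExp_add]
  ring

theorem zwegersTerm_tau_add_one (v : ℂ) (n : ℤ) :
    zwegersTerm M (τ + 1) v n = (e (n ^ 2 / (4 * M)))⁻¹ * zwegersTerm M τ v n := by
  have harg : zwegersArg M (τ + 1) v n = zwegersArg M τ v n := by simp [zwegersArg]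
  rw [zwegersTerm_eq, zwegersTerm_eq, harg, thetaExp_tau_add_one]
  ring

/-- Zwegers' nonholomorphic correction of the Appell sum. -/
def appellCorr (M : ℕ) (τ u v : ℂ) : ℂ :=
  1 / 2 * ∑ j ∈ Finset.range (2 * M), zwegersR M j τ v * Theta j M τ (2 * u)

/-- The completed Appell sum, which transforms like a Jacobi form. -/
def appellMod (M : ℕ) (τ u v : ℂ) : ℂ := appell M τ u v - appellCorr M τ u v

theorem norm_Theta_le [NeZero M] (hτ : 0 < τ.im) (j : ℤ) (u : ℂ) :
    ‖Theta j M τ (2 * u)‖ ≤ ∑' n : ℤ, ‖thetaExp M τ u n‖ := by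
  have hinj := add_two_mul_mul_injective (M := M) j
  have hsum := (summable_thetaExp (M := M) hτ u).norm
  rw [Theta_two_mul]
  exact (norm_tsum_le_tsum_norm (hsum.comp_injective hinj)).trans
    (tsum_comp_le_tsum_of_inj hsum (fun _ => norm_nonneg _) hinj)

theorem summable_zwegersTerm_mul_Theta [NeZero M] (hτ : 0 < τ.im) (u v : ℂ) :
    Summable fun n : ℤ => zwegersTerm M τ v n * Theta n M τ (2 * u) :=
  .of_norm_bounded ((summable_zwegersTerm hτ v).norm.mul_right _) fun n =>
    (norm_mul_le _ _).trans (mul_le_mul_of_nonneg_left (norm_Theta_le hτ n u) (norm_nonneg _))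

theorem appellCorr_eq_tsum [NeZero M] (hτ : 0 < τ.im) (u v : ℂ) :
    appellCorr M τ u v = 1 / 2 * ∑' n : ℤ, zwegersTerm M τ v n * Theta n M τ (2 * u) := by
  rw [appellCorr, tsum_int_eq_sum_range_tsum (2 * M) (summable_zwegersTerm_mul_Theta hτ u v)]
  congr 1
  refine Finset.sum_congr rfl fun j _ => ?_
  rw [zwegersR_eq_tsum, ← tsum_mul_right]
  refine tsum_congr fun k => ?_
  have hperiod := (Theta_periodic (M := M) (τ := τ) (2 * u)).int_mul k (j : ℤ)
  rw [← hperiod]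
  push_cast
  rw [mul_comm k]

theorem appell_neg_neg [NeZero M] (hτ : 0 < τ.im) (h : OffLattice τ (u - v)) :
    appell M τ (-u) (-v) = Theta 0 M τ (2 * u) - appell M τ u v := by
  rw [Theta_two_mul, appell, appell, ← (Equiv.neg ℤ).tsum_eq]
  simp only [zero_add]
  rw [← (summable_thetaExp_two_mul_mul hτ u).tsum_sub (summable_appell hτ h)]
  refine tsum_congr fun n => ?_
  have hnum : thetaExp M τ (-u) (2 * M * -n) = thetaExp M τ u (2 * M * n) := by
    rw [mul_neg, thetaExp_neg_neg]
  have hden : e (-u - -v + ((-n : ℤ) : ℂ) * τ) = (e (u - v + n * τ))⁻¹ := by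
    rw [← e_neg]
    congr 1
    push_cast
    ring
  have hne : e (u - v + n * τ) ≠ 1 := offLattice_iff_e_ne_one.mp h n
  have hne_one_sub : 1 - e (u - v + n * τ) ≠ 0 := sub_ne_zero.mpr hne.symm
  have hne_sub_one : e (u - v + n * τ) - 1 ≠ 0 := sub_ne_zero.mpr hne
  have hne_zero := e_ne_zero (u - v + n * τ)
  rw [Equiv.neg_apply, hnum, hden]
  field_simp
  ring

theorem appellCorr_neg_neg [NeZero M] (hτ : 0 < τ.im) (u v : ℂ) :
    appellCorr M τ (-u) (-v) = Theta 0 M τ (2 * u) - appellCorr M τ u v := by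
  have hterm (n : ℤ) : zwegersTerm M τ (-v) (-n) * Theta (-n) M τ (2 * -u) =
      (if n = 0 then 2 * Theta 0 M τ (2 * u) else 0) -
        zwegersTerm M τ v n * Theta n M τ (2 * u) := by
    rw [zwegersTerm_neg_neg, Theta_neg_neg]
    split_ifs with hn
    · rw [hn]
      ring
    · ring
  rw [appellCorr_eq_tsum hτ, appellCorr_eq_tsum hτ, ← (Equiv.neg ℤ).tsum_eq]
  simp only [Equiv.neg_apply, hterm]
  rw [((hasSum_ite_eq 0 _).summable).tsum_sub (summable_zwegersTerm_mul_Theta hτ u v), tsum_ite_eq]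
  ring

theorem appellMod_neg_neg [NeZero M] (hτ : 0 < τ.im) (h : OffLattice τ (u - v)) :
    appellMod M τ (-u) (-v) = -appellMod M τ u v := by
  rw [appellMod, appellMod, appell_neg_neg hτ h, appellCorr_neg_neg hτ]
  ring

theorem hasSum_ite_nonneg_and_lt {A : Type*} [AddCommMonoid A] [TopologicalSpace A] (N : ℕ)
    (g : ℤ → A) :
    HasSum (fun n : ℤ => if 0 ≤ n ∧ n < N then g n else 0) (∑ k ∈ Finset.range N, g k) := by
  have h := hasSum_sum_of_ne_finset_zero (L := SummationFilter.unconditional ℤ)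
    (f := fun n : ℤ => if 0 ≤ n ∧ n < N then g n else 0)
    (s := (Finset.range N).map Nat.castEmbedding) fun n hn => if_neg fun hnN => hn ?_
  · rw [Finset.sum_map] at h
    convert h using 1
    exact Finset.sum_congr rfl fun k hk => (if_pos (by simpa using hk)).symm
  · lift n to ℕ using hnN.1
    simpa using hnN

theorem thetaExp_two_mul_mul_mul_e_pow [NeZero M] (u v : ℂ) (k : ℕ) (n : ℤ) :
    thetaExp M τ u (2 * M * n) * e (u - v + n * τ) ^ k =
      (thetaExp M τ v k)⁻¹ * thetaExp M τ u (k + 2 * M * n) := by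
  have : (M : ℂ) ≠ 0 := NeZero.ne _
  rw [eq_inv_mul_iff_mul_eq₀ (thetaExp_ne_zero v k), ← e_natCast_mul]
  simp only [thetaExp, ← e_add]
  congr 1
  push_cast
  field_simp
  ring

theorem hasSum_thetaExp_mul_e_pow [NeZero M] (hτ : 0 < τ.im) (u v : ℂ) (k : ℕ) :
    HasSum (fun n : ℤ => thetaExp M τ u (2 * M * n) * e (u - v + n * τ) ^ k)
      ((thetaExp M τ v k)⁻¹ * Theta k M τ (2 * u)) := by
  simp only [thetaExp_two_mul_mul_mul_e_pow, Theta_two_mul]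
  exact (((summable_thetaExp hτ u).comp_injective
    (add_two_mul_mul_injective (k : ℤ))).hasSum).mul_left _

theorem appell_add_half [NeZero M] (hτ : 0 < τ.im) (h : OffLattice τ (u - v)) :
    appell M τ (u + τ / 2) (v + τ / 2) = e (M * (v - u)) *
      (appell M τ u v - ∑ k ∈ Finset.range M, (thetaExp M τ v k)⁻¹ * Theta k M τ (2 * u)) := by
  have hpow := hasSum_sum (s := Finset.range M) fun k _ =>
    hasSum_thetaExp_mul_e_pow (M := M) hτ u v k
  rw [← hpow.tsum_eq, appell, appell, ← (summable_appell hτ h).tsum_sub hpow.summable,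
    ← tsum_mul_left]
  refine tsum_congr fun n => ?_
  have hden : 1 - e (u - v + n * τ) ≠ 0 := sub_ne_zero.mpr (offLattice_iff_e_ne_one.mp h n).symm
  have hnum : thetaExp M τ (u + τ / 2) (2 * M * n) =
      e (M * (v - u)) * (thetaExp M τ u (2 * M * n) * e (u - v + n * τ) ^ M) := by
    rw [thetaExp_add, ← e_natCast_mul, mul_left_comm, ← e_add, mul_comm]
    congr 2
    push_cast
    ring
  rw [hnum, add_sub_add_right_eq_sub, ← Finset.mul_sum]
  field_simp
  linear_combination e (M * (v - u)) * thetaExp M τ u (2 * M * n) *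
    geom_sum_mul_neg (e (u - v + n * τ)) M

theorem appellCorr_add_half [NeZero M] (hτ : 0 < τ.im) (u v : ℂ) :
    appellCorr M τ (u + τ / 2) (v + τ / 2) = e (M * (v - u)) *
      (appellCorr M τ u v - ∑ k ∈ Finset.range M, (thetaExp M τ v k)⁻¹ * Theta k M τ (2 * u)) := by
  have hTheta (n : ℤ) := Theta_add_intCast_mul_half (M := M) (τ := τ) n u 1
  simp only [Int.cast_one, one_mul, one_pow] at hTheta
  have hfactor : e (M * v + M * (τ / 4)) * e (-(M * u + M * (τ / 4))) = e (M * (v - u)) := by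
    rw [← e_add]
    ring_nf
  have hterm (n : ℤ) :
      zwegersTerm M τ (v + τ / 2) (n - M) * Theta (n - M) M τ (2 * (u + τ / 2)) =
        e (M * (v - u)) * (zwegersTerm M τ v n * Theta n M τ (2 * u) -
          if 0 ≤ n ∧ n < M then 2 * (thetaExp M τ v n)⁻¹ * Theta n M τ (2 * u) else 0) := by
    rw [zwegersTerm_add_half hτ, hTheta, ← hfactor]
    split_ifs <;> ring
  have hfinite := hasSum_ite_nonneg_and_lt M
    fun n : ℤ => 2 * (thetaExp M τ v n)⁻¹ * Theta n M τ (2 * u)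
  rw [appellCorr_eq_tsum hτ, appellCorr_eq_tsum hτ, ← (Equiv.subRight (M : ℤ)).tsum_eq]
  simp only [Equiv.subRight_apply, hterm]
  rw [tsum_mul_left, (summable_zwegersTerm_mul_Theta hτ u v).tsum_sub hfinite.summable,
    hfinite.tsum_eq]
  simp only [mul_assoc, ← Finset.mul_sum]
  ring

theorem appellMod_add_half [NeZero M] (hτ : 0 < τ.im) (h : OffLattice τ (u - v)) :
    appellMod M τ (u + τ / 2) (v + τ / 2) = e (M * (v - u)) * appellMod M τ u v := by
  rw [appellMod, appellMod, appell_add_half hτ h, appellCorr_add_half hτ]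
  ring

theorem appellMod_add_intCast_div_two_mul [NeZero M] (hτ : 0 < τ.im) (h : OffLattice τ (u - v))
    (l : ℤ) :
    appellMod M τ (u + l / 2 * τ) (v + l / 2 * τ) = e (l * M * (v - u)) * appellMod M τ u v := by
  have hstep (l : ℤ) : appellMod M τ (u + (l + 1 : ℤ) / 2 * τ) (v + (l + 1 : ℤ) / 2 * τ) =
      e (M * (v - u)) * appellMod M τ (u + l / 2 * τ) (v + l / 2 * τ) := by
    have hhalf := appellMod_add_half (M := M) (u := u + l / 2 * τ) (v := v + l / 2 * τ) hτ
      (by rwa [add_sub_add_right_eq_sub])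
    rw [add_sub_add_right_eq_sub] at hhalf
    rw [← hhalf]
    congr 1 <;> (push_cast; ring)
  have hfactor (l : ℤ) :
      e ((l + 1 : ℤ) * M * (v - u)) = e (M * (v - u)) * e (l * M * (v - u)) := by
    rw [← e_add]
    congr 1
    push_cast
    ring
  induction l using Int.induction_on with
  | zero => simp [e_zero]
  | succ i ih => rw [hstep, ih, hfactor, ← mul_assoc]
  | pred i ih =>
    have hprev := hstep (-i - 1)
    have hfactor' := hfactor (-i - 1)
    rw [sub_add_cancel] at hprev hfactor'
    rwa [ih, hfactor', mul_assoc, mul_right_inj' (e_ne_zero _), eq_comm] at hprev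

theorem appell_add_intCast_mul_tau [NeZero M] (u v : ℂ) (n : ℤ) :
    appell M τ (u + n * τ) v =
      e (-(2 * n * M * u + n ^ 2 * M * τ)) * appell M τ u v := by
  rw [appell, appell, ← tsum_mul_left, ← (Equiv.subRight n).tsum_eq]
  refine tsum_congr fun k => ?_
  have hnum : thetaExp M τ (u + n * τ) (2 * M * (k - n)) =
      e (-(2 * n * M * u + n ^ 2 * M * τ)) * thetaExp M τ u (2 * M * k) := by
    have h := thetaExp_add_intCast_mul_half (M := M) (τ := τ) u (2 * n) (2 * M * k)
    convert h using 2 <;> (push_cast; ring_nf)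
  have hden : u + n * τ - v + ((k - n : ℤ) : ℂ) * τ = u - v + k * τ := by
    push_cast
    ring
  rw [Equiv.subRight_apply, hnum, hden, mul_div_assoc]

theorem appellMod_add_intCast_mul_tau [NeZero M] (u v : ℂ) (n : ℤ) :
    appellMod M τ (u + n * τ) v =
      e (-(2 * n * M * u + n ^ 2 * M * τ)) * appellMod M τ u v := by
  simp only [appellMod, appellCorr, appell_add_intCast_mul_tau, Theta_add_intCast_mul_tau, mul_sub,
    Finset.mul_sum]
  congr 1
  exact Finset.sum_congr rfl fun j _ => by ring

theorem appellMod_add_mul_tau [NeZero M] (hτ : 0 < τ.im) (h : OffLattice τ (u - v)) {a b : ℝ}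
    (hab : IsHalfIntegralPair a b) :
    appellMod M τ (u + a * τ) (v + b * τ) =
      e (M * ((b ^ 2 - a ^ 2) * τ + 2 * (-a * u + b * v))) * appellMod M τ u v := by
  obtain ⟨-, ⟨l, rfl⟩, ⟨n, hn⟩⟩ := hab
  obtain rfl : a = n - l / 2 := by linarith
  have hu : u + (n - l / 2 : ℝ) * τ = u + l / 2 * τ + (n - l : ℤ) * τ := by
    push_cast
    ring
  have hv : v + (l / 2 : ℝ) * τ = v + l / 2 * τ := by push_cast; rfl
  rw [hu, hv, appellMod_add_intCast_mul_tau, appellMod_add_intCast_div_two_mul hτ h, ← mul_assoc,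
    ← e_add]
  congr 2
  push_cast
  ring

theorem appellMod_add_real [NeZero M] (hτ : 0 < τ.im) (u v : ℂ) {a b : ℝ}
    (hab : IsHalfIntegralPair a b) : appellMod M τ (u + a) (v + b) = appellMod M τ u v := by
  obtain ⟨⟨k, rfl⟩, ⟨l, rfl⟩, ⟨n, hn⟩⟩ := hab
  have hkl : (k : ℂ) = 2 * n - l := by
    have : (k : ℝ) = 2 * n - l := by linarith
    exact_mod_cast this
  have happell : appell M τ (u + k / 2) (v + l / 2) = appell M τ u v := by
    refine tsum_congr fun i => ?_
    have hnum : e (((2 * M * i : ℤ) : ℂ) * (k / 2)) = 1 :=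
      e_eq_one_iff.mpr ⟨M * i * k, by push_cast; ring⟩
    have hden : e (u + k / 2 - (v + l / 2) + i * τ) = e (u - v + i * τ) :=
      e_eq_e_of_eq_add_intCast (n - l) (by rw [hkl]; push_cast; ring)
    rw [thetaExp_add, hnum, one_mul, hden]
  have hcorr : appellCorr M τ (u + k / 2) (v + l / 2) = appellCorr M τ u v := by
    simp only [appellCorr_eq_tsum hτ, zwegersTerm_add_intCast_div_two, Theta_add_intCast_div_two]
    congr 1
    refine tsum_congr fun j => ?_
    have hfactor : e (j * (k / 2)) = e (j * (l / 2)) :=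
      e_eq_e_of_eq_add_intCast (j * (n - l)) (by rw [hkl]; push_cast; ring)
    rw [hfactor, mul_mul_mul_comm, inv_mul_cancel₀ (e_ne_zero _), one_mul]
  push_cast
  rw [appellMod, happell, hcorr, appellMod]

theorem appellMod_tau_add_one [NeZero M] (hτ : 0 < τ.im) (u v : ℂ) :
    appellMod M (τ + 1) u v = appellMod M τ u v := by
  have : (M : ℂ) ≠ 0 := NeZero.ne _
  have happell : appell M (τ + 1) u v = appell M τ u v := by
    refine tsum_congr fun i => ?_
    have hnum : e (((2 * M * i : ℤ) : ℂ) ^ 2 / (4 * M)) = 1 :=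
      e_eq_one_iff.mpr ⟨M * i ^ 2, by push_cast; field_simp; ring⟩
    have hden : e (u - v + i * (τ + 1)) = e (u - v + i * τ) :=
      e_eq_e_of_eq_add_intCast i (by ring)
    rw [thetaExp_tau_add_one, hnum, one_mul, hden]
  have hcorr : appellCorr M (τ + 1) u v = appellCorr M τ u v := by
    rw [appellCorr_eq_tsum (by simpa using hτ), appellCorr_eq_tsum hτ]
    congr 1
    refine tsum_congr fun j => ?_
    rw [zwegersTerm_tau_add_one, Theta_tau_add_one, mul_mul_mul_comm,
      inv_mul_cancel₀ (e_ne_zero _), one_mul]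
  rw [appellMod, happell, hcorr, appellMod]

end EllipticTransformations

section Inversion

variable {M : ℕ} {τ u v : ℂ}

theorem exists_hasWirtingerAt_appellCorr [NeZero M] (hτ : 0 < τ.im) (u v : ℂ) :
    ∃ a, HasWirtingerAt (fun v => appellCorr M τ u v) a
      (1 / 2 * (dbarFactor M τ v * thetaKernel M τ u v)) v := by
  choose a ha using fun j : ℕ => exists_hasWirtingerAt_zwegersR (M := M) hτ j v
  have hconst (c : ℂ) : HasWirtingerAt (fun _ => c) 0 0 v :=
    .of_hasDerivAt (hasDerivAt_const v c)
  have hsum := (hconst (1 / 2)).mul (HasWirtingerAt.sum (s := Finset.range (2 * M))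
    fun j _ => (ha j).mul (hconst (Theta j M τ (2 * u))))
  simp only [mul_zero, zero_mul, zero_add, add_zero, mul_assoc, ← Finset.mul_sum] at hsum
  exact ⟨_, hsum⟩

theorem exists_hasWirtingerAt_appellMod [NeZero M] (hτ : 0 < τ.im) (h : OffLattice τ (u - v)) :
    ∃ a, HasWirtingerAt (fun v => appellMod M τ u v) a
      (-(1 / 2 * (dbarFactor M τ v * thetaKernel M τ u v))) v := by
  obtain ⟨a, ha⟩ := exists_hasWirtingerAt_appellCorr (M := M) hτ u v
  have happell := differentiableAt_appell (M := M) hτ h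
  have hsub := (HasWirtingerAt.of_hasDerivAt happell.hasDerivAt).sub ha
  rw [zero_sub] at hsub
  exact ⟨_, hsub⟩

theorem tendsto_mul_appellMod [NeZero M] (hτ : 0 < τ.im) (u : ℂ) :
    Tendsto (fun v => (v - u) * appellMod M τ u v) (𝓝[≠] u) (𝓝 (2 * π * I)⁻¹) := by
  obtain ⟨a, ha⟩ := exists_hasWirtingerAt_appellCorr (M := M) hτ u u
  have hcorr : Tendsto (fun v => (v - u) * appellCorr M τ u v) (𝓝[≠] u)
      (𝓝 ((u - u) * appellCorr M τ u u)) :=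
    ((continuousAt_id.sub continuousAt_const).mul
      (HasFDerivAt.continuousAt ha)).tendsto.mono_left nhdsWithin_le_nhds
  have hsub := (tendsto_mul_appell (M := M) hτ u).sub hcorr
  rw [sub_self, zero_mul, sub_zero] at hsub
  simpa only [appellMod, mul_sub] using hsub

theorem im_neg_one_div (τ : ℂ) : (-1 / τ).im = τ.im / ‖τ‖ ^ 2 := by
  rw [neg_div, one_div, Complex.neg_im, Complex.inv_im, Complex.normSq_eq_norm_sq]
  ring

theorem im_neg_one_div_pos (hτ : 0 < τ.im) : 0 < (-1 / τ).im := by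
  rw [im_neg_one_div]
  have := norm_pos_iff.mpr (ne_zero_of_im_pos hτ)
  positivity

theorem OffLattice.neg_one_div {w : ℂ} (hτ : 0 < τ.im) (h : OffLattice τ w) :
    OffLattice (-1 / τ) (w / τ) := by
  intro j k hjk
  have := ne_zero_of_im_pos hτ
  refine h (-k) j ?_
  field_simp at hjk
  rw [hjk]
  push_cast
  ring

theorem zwegersSlope_neg_one_div (M : ℕ) (hτ : 0 < τ.im) :
    zwegersSlope M (-1 / τ) = ‖τ‖ * zwegersSlope M τ := by
  have hn := norm_pos_iff.mpr (ne_zero_of_im_pos hτ)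
  have hsqrt : √(τ.im / ‖τ‖ ^ 2 / M) = √(τ.im / M) / ‖τ‖ := by
    rw [div_right_comm, Real.sqrt_div' _ (by positivity), Real.sqrt_sq hn.le]
  rw [zwegersSlope, zwegersSlope, im_neg_one_div, hsqrt]
  field_simp

theorem im_div_sq_div_im_neg_one_div (hτ : 0 < τ.im) (v : ℂ) :
    (v / τ).im ^ 2 / (-1 / τ).im = v.im ^ 2 / τ.im - (v ^ 2 / τ).im := by
  have hnorm := Complex.normSq_pos.mpr (ne_zero_of_im_pos hτ)
  rw [im_neg_one_div, ← Complex.normSq_eq_norm_sq, Complex.div_im, Complex.div_im, sq v,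
    Complex.mul_re, Complex.mul_im]
  field_simp
  rw [Complex.normSq_apply]
  ring

theorem dbarFactor_neg_one_div (M : ℕ) (hτ : 0 < τ.im) (v : ℂ) :
    dbarFactor M (-1 / τ) (v / τ) * (conj (e (M * v ^ 2 / τ)) * e (M * v ^ 2 / τ)) =
      ‖τ‖ * dbarFactor M τ v := by
  have him : (M * v ^ 2 / τ : ℂ).im = M * (v ^ 2 / τ).im := by
    rw [mul_div_assoc, ← Complex.ofReal_natCast, Complex.im_ofReal_mul]
  have hnorm : conj (e (M * v ^ 2 / τ)) * e (M * v ^ 2 / τ) =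
      (Real.exp (-4 * π * (M * (v ^ 2 / τ).im)) : ℝ) := by
    rw [Complex.conj_mul', norm_e, him, ← Complex.ofReal_pow, ← Real.exp_nat_mul]
    congr 2
    push_cast
    ring
  have hexp : Real.exp (-4 * π * M * (v / τ).im ^ 2 / (-1 / τ).im) *
      Real.exp (-4 * π * (M * (v ^ 2 / τ).im)) = Real.exp (-4 * π * M * v.im ^ 2 / τ.im) := by
    rw [← Real.exp_add]
    congr 1
    linear_combination (-4 * π * M) * im_div_sq_div_im_neg_one_div hτ v
  rw [hnorm, dbarFactor, dbarFactor, zwegersSlope_neg_one_div M hτ, ← hexp]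
  push_cast
  ring

theorem dbarFactor_mul_thetaKernel_neg_one_div [NeZero M] (hτ : 0 < τ.im) (u v : ℂ) :
    e (-(M * (u ^ 2 - v ^ 2) / τ)) *
        (dbarFactor M (-1 / τ) (v / τ) * thetaKernel M (-1 / τ) (u / τ) (v / τ)) =
      ‖τ‖ ^ 2 * (dbarFactor M τ v * thetaKernel M τ u v) := by
  have hexp : e (-(M * (u ^ 2 - v ^ 2) / τ)) * e (M * u ^ 2 / τ) = e (M * v ^ 2 / τ) := by
    rw [← e_add]
    ring_nf
  calc
    _ = ‖τ‖ * thetaKernel M τ u v * (dbarFactor M (-1 / τ) (v / τ) *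
          (conj (e (M * v ^ 2 / τ)) * e (M * v ^ 2 / τ))) := by
      rw [thetaKernel_neg_one_div hτ, ← hexp]
      ring
    _ = ‖τ‖ ^ 2 * (dbarFactor M τ v * thetaKernel M τ u v) := by
      rw [dbarFactor_neg_one_div M hτ]
      ring

/-- The failure of the completed Appell sum to transform under `τ ↦ -1/τ`, as a function of `v`. -/
def inversionDefect (M : ℕ) (τ u v : ℂ) : ℂ :=
  τ * appellMod M τ u v -
    e (-(M * (u ^ 2 - v ^ 2) / τ)) * appellMod M (-1 / τ) (u / τ) (v / τ)

theorem differentiableAt_inversionDefect [NeZero M] (hτ : 0 < τ.im) (h : OffLattice τ (u - v)) :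
    DifferentiableAt ℂ (inversionDefect M τ u) v := by
  have hinv : OffLattice (-1 / τ) (u / τ - τ⁻¹ * v) := by
    convert h.neg_one_div hτ using 1
    ring
  obtain ⟨a, ha⟩ := exists_hasWirtingerAt_appellMod (M := M) hτ h
  obtain ⟨b, hb⟩ := exists_hasWirtingerAt_appellMod (M := M) (im_neg_one_div_pos hτ) hinv
  have hexp : DifferentiableAt ℂ (fun v => e (-(M * (u ^ 2 - v ^ 2) / τ))) v := by fun_prop
  have hdefect := ((HasWirtingerAt.of_hasDerivAt (hasDerivAt_const v τ)).mul ha).sub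
    ((HasWirtingerAt.of_hasDerivAt hexp.hasDerivAt).mul hb.comp_const_mul)
  simp only [← div_eq_inv_mul, zero_mul, add_zero] at hdefect
  have hdbar : τ * -(1 / 2 * (dbarFactor M τ v * thetaKernel M τ u v)) -
      e (-(M * (u ^ 2 - v ^ 2) / τ)) * (-(1 / 2 * (dbarFactor M (-1 / τ) (v / τ) *
        thetaKernel M (-1 / τ) (u / τ) (v / τ))) * conj τ⁻¹) = 0 := by
    have hconj : conj τ⁻¹ * ‖τ‖ ^ 2 = τ := by
      have : conj τ ≠ 0 := (map_ne_zero _).mpr (ne_zero_of_im_pos hτ)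
      rw [map_inv₀, ← Complex.conj_mul']
      field_simp
    linear_combination conj τ⁻¹ / 2 * dbarFactor_mul_thetaKernel_neg_one_div (M := M) hτ u v +
      dbarFactor M τ v * thetaKernel M τ u v / 2 * hconj
  rw [hdbar] at hdefect
  exact hdefect.differentiableAt

theorem isHalfIntegralPair_intCast (a b : ℤ) : IsHalfIntegralPair a b :=
  ⟨⟨2 * a, by push_cast; ring⟩, ⟨2 * b, by push_cast; ring⟩, ⟨a + b, by push_cast; ring⟩⟩

theorem inversionDefect_add_one [NeZero M] (hτ : 0 < τ.im) (h : OffLattice τ (u - v)) :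
    inversionDefect M τ u (v + 1) = inversionDefect M τ u v := by
  have := ne_zero_of_im_pos hτ
  have hinv : OffLattice (-1 / τ) (u / τ - v / τ) := by
    rw [← sub_div]
    exact h.neg_one_div hτ
  have hone := appellMod_add_real (M := M) hτ u v (isHalfIntegralPair_intCast 0 1)
  have hperiod := appellMod_add_mul_tau (M := M) (im_neg_one_div_pos hτ) hinv
    (isHalfIntegralPair_intCast 0 (-1))
  simp only [Int.cast_zero, Int.cast_one, Int.cast_neg, Complex.ofReal_zero, Complex.ofReal_one,
    Complex.ofReal_neg, add_zero, zero_mul] at hone hperiod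
  have hv : (v + 1) / τ = v / τ + -1 * (-1 / τ) := by ring
  rw [inversionDefect, inversionDefect, hone, hv, hperiod, ← mul_assoc, ← e_add]
  congr 3
  field_simp
  ring

theorem inversionDefect_add_tau [NeZero M] (hτ : 0 < τ.im) (h : OffLattice τ (u - v)) :
    inversionDefect M τ u (v + τ) = e (M * (2 * v + τ)) * inversionDefect M τ u v := by
  have := ne_zero_of_im_pos hτ
  have hperiod := appellMod_add_mul_tau (M := M) hτ h (isHalfIntegralPair_intCast 0 1)
  have hone := appellMod_add_real (M := M) (im_neg_one_div_pos hτ) (u / τ) (v / τ)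
    (isHalfIntegralPair_intCast 0 1)
  simp only [Int.cast_zero, Int.cast_one, Complex.ofReal_zero, Complex.ofReal_one,
    add_zero, zero_mul, one_mul, one_pow, zero_pow two_ne_zero, sub_zero, neg_zero, zero_add,
    add_comm τ] at hperiod hone
  have hv : (v + τ) / τ = v / τ + 1 := by field_simp
  have hexp : e (-(M * (u ^ 2 - (v + τ) ^ 2) / τ)) =
      e (M * (2 * v + τ)) * e (-(M * (u ^ 2 - v ^ 2) / τ)) := by
    rw [← e_add]
    congr 1
    field_simp
    ring
  rw [inversionDefect, inversionDefect, hperiod, hv, hone, hexp]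
  ring

theorem tendsto_mul_inversionDefect [NeZero M] (hτ : 0 < τ.im) (u : ℂ) :
    Tendsto (fun v => (v - u) * inversionDefect M τ u v) (𝓝[≠] u) (𝓝 0) := by
  have hτ0 := ne_zero_of_im_pos hτ
  have hdiv : Tendsto (fun v : ℂ => v / τ) (𝓝[≠] u) (𝓝[≠] (u / τ)) := by
    simp only [div_eq_mul_inv]
    exact ((Homeomorph.mulRight₀ τ⁻¹ (inv_ne_zero hτ0)).map_punctured_nhds_eq u).le
  have hexp : Tendsto (fun v => e (-(M * (u ^ 2 - v ^ 2) / τ))) (𝓝[≠] u) (𝓝 1) := by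
    have hcont : Continuous fun v => e (-(M * (u ^ 2 - v ^ 2) / τ)) := by fun_prop
    simpa [e_zero] using (hcont.tendsto u).mono_left (nhdsWithin_le_nhds (s := {u}ᶜ))
  have hlim := ((tendsto_mul_appellMod (M := M) hτ u).const_mul τ).sub (hexp.mul
    (((tendsto_mul_appellMod (M := M) (im_neg_one_div_pos hτ) (u / τ)).comp hdiv).const_mul τ))
  rw [one_mul, sub_self] at hlim
  refine hlim.congr fun v => ?_
  simp only [inversionDefect, Function.comp_apply]
  field_simp

theorem appellMod_neg_one_div [NeZero M] (hτ : 0 < τ.im) (h : OffLattice τ (u - v)) :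
    appellMod M (-1 / τ) (u / τ) (v / τ) =
      τ * e (M * (u ^ 2 - v ^ 2) / τ) * appellMod M τ u v := by
  have hdefect : inversionDefect M τ u v = 0 :=
    eq_zero_of_quasiperiodic hτ (fun _ hv => differentiableAt_inversionDefect hτ hv)
      (tendsto_mul_inversionDefect hτ u) (fun _ hv => inversionDefect_add_one hτ hv)
      (fun _ hv => inversionDefect_add_tau hτ hv) h
  rw [inversionDefect, sub_eq_zero, e_neg] at hdefect
  have := e_ne_zero (M * (u ^ 2 - v ^ 2) / τ)
  rw [mul_right_comm, hdefect]
  field_simp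

end Inversion

section ModifiedNumerators

variable (m : ℕ) {τ u v z₁ z₂ : ℂ}

theorem numeratorTerm_eq (τ z₁ z₂ : ℂ) (j : ℤ) :
    numeratorTerm m τ z₁ z₂ j =
      thetaExp (m + 1) τ ((z₁ + z₂) / 2) (2 * (m + 1 : ℕ) * j) / (1 - e (z₁ + j * τ)) -
        thetaExp (m + 1) τ (-((z₁ + z₂) / 2)) (2 * (m + 1 : ℕ) * j) / (1 - e (-z₂ + j * τ)) := by
  have hm : (m : ℂ) + 1 ≠ 0 := m.cast_add_one_ne_zero
  simp only [numeratorTerm, qPow_eq_e, thetaExp, ← e_add, mul_comm τ]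
  push_cast
  congr! 3 <;>
  · field_simp
    ring

theorem isRegular_iff_offLattice : IsRegular τ z₁ z₂ ↔ OffLattice τ z₁ ∧ OffLattice τ z₂ := by
  simp only [IsRegular, OffLattice, forall_and]

theorem summable_numeratorTerm (hτ : 0 < τ.im) (h : IsRegular τ z₁ z₂) :
    Summable (numeratorTerm m τ z₁ z₂) := by
  obtain ⟨h₁, h₂⟩ := isRegular_iff_offLattice.mp h
  simp only [funext (numeratorTerm_eq m τ z₁ z₂)]
  exact (summable_div_one_sub_e hτ (summable_thetaExp_two_mul_mul hτ _) h₁).sub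
    (summable_div_one_sub_e hτ (summable_thetaExp_two_mul_mul hτ _) h₂.neg)

theorem tsum_numeratorTerm (hτ : 0 < τ.im) (h₁ : OffLattice τ (u - v))
    (h₂ : OffLattice τ (-u - v)) :
    ∑' j : ℤ, numeratorTerm m τ (v - u) (-u - v) j =
      appell (m + 1) τ (-u) v - appell (m + 1) τ u v := by
  have h₁' : OffLattice τ (-u - -v) := by simpa [neg_add_eq_sub] using h₁.neg
  have h₂' : OffLattice τ (u - -v) := by simpa [add_comm] using h₂.neg
  have hmid : (v - u + (-u - v)) / 2 = -u := by ring
  have hfst : v - u = -u - -v := by ring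
  have hsnd : -(-u - v) = u - -v := by ring
  have hTheta : Theta 0 (m + 1) τ (2 * -u) = Theta 0 (m + 1) τ (2 * u) := by
    simpa using Theta_neg_neg (M := m + 1) (τ := τ) 0 u
  have hneg := appell_neg_neg (M := m + 1) hτ h₂
  rw [neg_neg, hTheta] at hneg
  simp only [numeratorTerm_eq, hmid, hsnd, neg_neg]
  rw [hfst, (summable_appell hτ h₁').tsum_sub (summable_appell hτ h₂'), ← appell, ← appell,
    appell_neg_neg hτ h₁, hneg]
  ring

theorem phiAdd_eq (τ u v t : ℂ) :
    phiAdd m τ u v t =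
      e ((m + 1) * t) * (appellCorr (m + 1) τ u v - appellCorr (m + 1) τ (-u) v) := by
  have hTheta (j : ℕ) :
      Theta (-(j : ℤ)) (m + 1) τ (2 * u) = Theta j (m + 1) τ (2 * -u) := by
    rw [← Theta_neg_neg, neg_neg]
  simp only [phiAdd, appellCorr, hTheta, mul_sub, Finset.sum_sub_distrib, mul_add_one 2 m]
  ring

theorem phiTilde_eq (hτ : 0 < τ.im) (h₁ : OffLattice τ (u - v)) (h₂ : OffLattice τ (-u - v))
    (t : ℂ) :
    phiTilde m τ u v t =
      e ((m + 1) * t) * (appellMod (m + 1) τ (-u) v - appellMod (m + 1) τ u v) := by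
  rw [phiTilde, phi, Phi, tsum_numeratorTerm m hτ h₁ h₂, phiAdd_eq, appellMod, appellMod]
  ring

theorem phiTilde_neg_one_div (hτ : 0 < τ.im) (h₁ : OffLattice τ (u - v))
    (h₂ : OffLattice τ (-u - v)) (t : ℂ) :
    phiTilde m (-1 / τ) (u / τ) (v / τ) (t - (u ^ 2 - v ^ 2) / τ) = τ * phiTilde m τ u v t := by
  have h₁' : OffLattice (-1 / τ) (u / τ - v / τ) := by
    rw [← sub_div]
    exact h₁.neg_one_div hτ
  have h₂' : OffLattice (-1 / τ) (-(u / τ) - v / τ) := by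
    rw [← neg_div, ← sub_div]
    exact h₂.neg_one_div hτ
  have hexp : e ((m + 1) * t) = e ((m + 1) * (t - (u ^ 2 - v ^ 2) / τ)) *
      e ((m + 1 : ℕ) * (u ^ 2 - v ^ 2) / τ) := by
    rw [← e_add]
    congr 1
    push_cast
    ring
  rw [phiTilde_eq m (im_neg_one_div_pos hτ) h₁' h₂', phiTilde_eq m hτ h₁ h₂, ← neg_div,
    appellMod_neg_one_div hτ h₁, appellMod_neg_one_div hτ h₂, neg_sq, hexp]
  ring

theorem IsHalfIntegralPair.neg_left {a b : ℝ} (h : IsHalfIntegralPair a b) :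
    IsHalfIntegralPair (-a) b := by
  obtain ⟨⟨k, rfl⟩, ⟨l, rfl⟩, ⟨n, hn⟩⟩ := h
  refine ⟨⟨-k, by push_cast; ring⟩, ⟨l, rfl⟩, ⟨l - n, ?_⟩⟩
  push_cast
  linarith

theorem IsHalfIntegralPair.exists_sub_eq_intCast {a b : ℝ} (h : IsHalfIntegralPair a b) :
    ∃ n : ℤ, (a - b : ℂ) = n := by
  obtain ⟨-, ⟨l, rfl⟩, ⟨n, hn⟩⟩ := h
  refine ⟨n - l, ?_⟩
  obtain rfl : a = n - l / 2 := by linarith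
  push_cast
  ring

theorem OffLattice.add_real {a b : ℝ} (h : OffLattice τ (u - v)) (hab : IsHalfIntegralPair a b) :
    OffLattice τ (u + a - (v + b)) := by
  obtain ⟨n, hn⟩ := hab.exists_sub_eq_intCast
  convert h.add n 0 using 1
  rw [← hn]
  push_cast
  ring

theorem OffLattice.add_mul_tau {a b : ℝ} (h : OffLattice τ (u - v))
    (hab : IsHalfIntegralPair a b) : OffLattice τ (u + a * τ - (v + b * τ)) := by
  obtain ⟨n, hn⟩ := hab.exists_sub_eq_intCast
  convert h.add 0 n using 1
  rw [← hn]
  push_cast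
  ring

theorem OffLattice.tau_add_one {w : ℂ} (h : OffLattice τ w) : OffLattice (τ + 1) w :=
  fun j k hjk => h (j + k) k <| by
    rw [hjk]
    push_cast
    ring

theorem phiTilde_add_real (hτ : 0 < τ.im) (h₁ : OffLattice τ (u - v))
    (h₂ : OffLattice τ (-u - v)) (t : ℂ) {a b : ℝ} (hab : IsHalfIntegralPair a b) :
    phiTilde m τ (u + a) (v + b) t = phiTilde m τ u v t := by
  have hneg : -(u + a) = -u + (-a : ℝ) := by
    push_cast
    ring
  have h₂' := h₂.add_real hab.neg_left
  rw [← hneg] at h₂'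
  rw [phiTilde_eq m hτ (h₁.add_real hab) h₂', phiTilde_eq m hτ h₁ h₂, hneg,
    appellMod_add_real hτ _ _ hab, appellMod_add_real hτ _ _ hab.neg_left]

theorem phiTilde_neg_right (hτ : 0 < τ.im) (h₁ : OffLattice τ (u - v))
    (h₂ : OffLattice τ (-u - v)) (t : ℂ) :
    phiTilde m τ u (-v) t = phiTilde m τ u v t := by
  have h₁' : OffLattice τ (u - -v) := by simpa [add_comm] using h₂.neg
  have h₂' : OffLattice τ (-u - -v) := by simpa [neg_add_eq_sub] using h₁.neg
  have hneg := appellMod_neg_neg (M := m + 1) hτ h₂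
  rw [neg_neg] at hneg
  rw [phiTilde_eq m hτ h₁' h₂', phiTilde_eq m hτ h₁ h₂, appellMod_neg_neg hτ h₁, hneg]
  ring

theorem phiTilde_neg_left (hτ : 0 < τ.im) (h₁ : OffLattice τ (u - v))
    (h₂ : OffLattice τ (-u - v)) (t : ℂ) :
    phiTilde m τ (-u) v t = -phiTilde m τ u v t := by
  rw [phiTilde_eq m hτ h₂ (by rwa [neg_neg]), phiTilde_eq m hτ h₁ h₂, neg_neg]
  ring

theorem phiTilde_tau_add_one (hτ : 0 < τ.im) (h₁ : OffLattice τ (u - v))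
    (h₂ : OffLattice τ (-u - v)) (t : ℂ) :
    phiTilde m (τ + 1) u v t = phiTilde m τ u v t := by
  rw [phiTilde_eq m (by simpa using hτ) h₁.tau_add_one h₂.tau_add_one, phiTilde_eq m hτ h₁ h₂,
    appellMod_tau_add_one hτ, appellMod_tau_add_one hτ]

theorem phiTilde_add_mul_tau (hτ : 0 < τ.im) (h₁ : OffLattice τ (u - v))
    (h₂ : OffLattice τ (-u - v)) (t : ℂ) {a b : ℝ} (hab : IsHalfIntegralPair a b) :
    phiTilde m τ (u + a * τ) (v + b * τ) t =
      qPow τ ((m + 1) * ((b : ℂ) ^ 2 - (a : ℂ) ^ 2)) *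
        Complex.exp (4 * π * I * (m + 1) * (-a * u + b * v)) * phiTilde m τ u v t := by
  have hneg : -(u + a * τ) = -u + (-a : ℝ) * τ := by
    push_cast
    ring
  have h₂' := h₂.add_mul_tau hab.neg_left
  rw [← hneg] at h₂'
  have hfactor : qPow τ ((m + 1) * ((b : ℂ) ^ 2 - (a : ℂ) ^ 2)) *
      Complex.exp (4 * π * I * (m + 1) * (-a * u + b * v)) =
        e ((m + 1 : ℕ) * ((b ^ 2 - a ^ 2) * τ + 2 * (-a * u + b * v))) := by
    rw [qPow, e, ← Complex.exp_add]
    congr 1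
    push_cast
    ring
  have hfactor_neg : e ((m + 1 : ℕ) * ((b ^ 2 - (-a : ℝ) ^ 2) * τ +
      2 * (-(-a : ℝ) * -u + b * v))) =
        e ((m + 1 : ℕ) * ((b ^ 2 - a ^ 2) * τ + 2 * (-a * u + b * v))) := by
    congr 1
    push_cast
    ring
  rw [phiTilde_eq m hτ (h₁.add_mul_tau hab) h₂', phiTilde_eq m hτ h₁ h₂, hneg, hfactor,
    appellMod_add_mul_tau hτ h₁ hab, appellMod_add_mul_tau hτ h₂ hab.neg_left, hfactor_neg]
  ring

theorem PhiTilde_eq_phiTilde (τ z₁ z₂ t : ℂ) :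
    PhiTilde m τ z₁ z₂ t = phiTilde m τ (-(z₁ + z₂) / 2) ((z₁ - z₂) / 2) t := by
  have hfst : (z₁ - z₂) / 2 - -(z₁ + z₂) / 2 = z₁ := by ring
  have hsnd : -(-(z₁ + z₂) / 2) - (z₁ - z₂) / 2 = z₂ := by ring
  have hTheta (j : ℤ) :
      Theta j (m + 1) τ (2 * (-(z₁ + z₂) / 2)) = Theta (-j) (m + 1) τ (z₁ + z₂) := by
    rw [neg_div, ← Theta_neg_neg, neg_neg, mul_div_cancel₀ _ two_ne_zero]
  simp only [PhiTilde, phiTilde, phi, hfst, hsnd, PhiAdd, phiAdd, hTheta, neg_neg, mul_sub,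
    Finset.sum_sub_distrib]
  ring

theorem IsRegular.offLattice_sub (h : IsRegular τ z₁ z₂) :
    OffLattice τ (-(z₁ + z₂) / 2 - (z₁ - z₂) / 2) := by
  convert (isRegular_iff_offLattice.mp h).1.neg using 1
  ring

theorem IsRegular.offLattice_neg_sub (h : IsRegular τ z₁ z₂) :
    OffLattice τ (-(-(z₁ + z₂) / 2) - (z₁ - z₂) / 2) := by
  convert (isRegular_iff_offLattice.mp h).2 using 1
  ring

theorem isHalfIntegralPair_neg_add_sub (a b : ℤ) :
    IsHalfIntegralPair (-(a + b) / 2) ((a - b) / 2) :=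
  ⟨⟨-(a + b), by push_cast; ring⟩, ⟨a - b, by push_cast; ring⟩, ⟨-b, by push_cast; ring⟩⟩

theorem PhiTilde_neg_one_div (hτ : 0 < τ.im) (h : IsRegular τ z₁ z₂) (t : ℂ) :
    PhiTilde m (-1 / τ) (z₁ / τ) (z₂ / τ) (t - z₁ * z₂ / τ) = τ * PhiTilde m τ z₁ z₂ t := by
  rw [PhiTilde_eq_phiTilde, PhiTilde_eq_phiTilde,
    ← phiTilde_neg_one_div m hτ h.offLattice_sub h.offLattice_neg_sub]
  congr 1 <;> ring

theorem PhiTilde_add_intCast (hτ : 0 < τ.im) (h : IsRegular τ z₁ z₂) (t : ℂ) (a b : ℤ) :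
    PhiTilde m τ (z₁ + a) (z₂ + b) t = PhiTilde m τ z₁ z₂ t := by
  rw [PhiTilde_eq_phiTilde, PhiTilde_eq_phiTilde,
    ← phiTilde_add_real m hτ h.offLattice_sub h.offLattice_neg_sub t
      (isHalfIntegralPair_neg_add_sub a b)]
  congr 1 <;> (push_cast; ring)

theorem PhiTilde_swap (hτ : 0 < τ.im) (h : IsRegular τ z₁ z₂) (t : ℂ) :
    PhiTilde m τ z₂ z₁ t = PhiTilde m τ z₁ z₂ t := by
  rw [PhiTilde_eq_phiTilde, PhiTilde_eq_phiTilde,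
    ← phiTilde_neg_right m hτ h.offLattice_sub h.offLattice_neg_sub]
  congr 1 <;> ring

theorem PhiTilde_neg_neg (hτ : 0 < τ.im) (h : IsRegular τ z₁ z₂) (t : ℂ) :
    PhiTilde m τ (-z₁) (-z₂) t = -PhiTilde m τ z₁ z₂ t := by
  have hswap : IsRegular τ z₂ z₁ := fun j k => (h j k).symm
  rw [← PhiTilde_swap m hτ h, PhiTilde_eq_phiTilde, PhiTilde_eq_phiTilde,
    ← phiTilde_neg_left m hτ hswap.offLattice_sub hswap.offLattice_neg_sub]
  congr 1 <;> ring

theorem PhiTilde_tau_add_one (hτ : 0 < τ.im) (h : IsRegular τ z₁ z₂) (t : ℂ) :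
    PhiTilde m (τ + 1) z₁ z₂ t = PhiTilde m τ z₁ z₂ t := by
  rw [PhiTilde_eq_phiTilde, PhiTilde_eq_phiTilde,
    phiTilde_tau_add_one m hτ h.offLattice_sub h.offLattice_neg_sub]

theorem PhiTilde_add_intCast_mul_tau (hτ : 0 < τ.im) (h : IsRegular τ z₁ z₂) (t : ℂ) (j k : ℤ) :
    PhiTilde m τ (z₁ + j * τ) (z₂ + k * τ) t =
      qPow τ (-((m + 1) * j * k)) * Complex.exp (-(2 * π * I * (m + 1) * (k * z₁ + j * z₂))) *
        PhiTilde m τ z₁ z₂ t := by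
  have hu : -(z₁ + j * τ + (z₂ + k * τ)) / 2 =
      -(z₁ + z₂) / 2 + (-(j + k) / 2 : ℝ) * τ := by
    push_cast
    ring
  have hv : (z₁ + j * τ - (z₂ + k * τ)) / 2 = (z₁ - z₂) / 2 + ((j - k) / 2 : ℝ) * τ := by
    push_cast
    ring
  rw [PhiTilde_eq_phiTilde, PhiTilde_eq_phiTilde, hu, hv,
    phiTilde_add_mul_tau m hτ h.offLattice_sub h.offLattice_neg_sub t
      (isHalfIntegralPair_neg_add_sub j k)]
  congr 3 <;> (push_cast; ring)

end ModifiedNumerators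

end ModifiedNumerator

end

open ModifiedNumerator in
theorem theorem5p9 (m : ℕ) :
    -- the series defining the functions converge
    (∀ τ : ℂ, 0 < τ.im →
      (∀ (j : ℤ) (z : ℂ), Summable (thetaTerm j (m + 1) τ z)) ∧
      (∀ (j : ℤ) (v : ℂ), Summable fun n : {n : ℤ // n ≡ j [ZMOD 2 * (m + 1 : ℕ)]} =>
        zwegersTerm (m + 1) τ v n) ∧
      (∀ z₁ z₂ : ℂ, IsRegular τ z₁ z₂ → Summable (numeratorTerm m τ z₁ z₂))) ∧
    -- the coordinates `(u, v)`
    (∀ τ u v t : ℂ, 0 < τ.im → IsRegular τ (v - u) (-u - v) →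
      phiTilde m (-1 / τ) (u / τ) (v / τ) (t - (u ^ 2 - v ^ 2) / τ) = τ * phiTilde m τ u v t ∧
      (∀ a b : ℝ, IsHalfIntegralPair a b →
        phiTilde m τ (u + a) (v + b) t = phiTilde m τ u v t) ∧
      (phiTilde m τ u (-v) t = phiTilde m τ u v t ∧
        phiTilde m τ (-u) v t = -phiTilde m τ u v t) ∧
      phiTilde m (τ + 1) u v t = phiTilde m τ u v t ∧
      (∀ a b : ℝ, IsHalfIntegralPair a b →
        phiTilde m τ (u + a * τ) (v + b * τ) t =
          qPow τ ((m + 1) * ((b : ℂ) ^ 2 - (a : ℂ) ^ 2)) *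
            Complex.exp (4 * Real.pi * Complex.I * (m + 1) * (-a * u + b * v)) *
            phiTilde m τ u v t)) ∧
    -- the coordinates `(z₁, z₂)`
    (∀ τ z₁ z₂ t : ℂ, 0 < τ.im → IsRegular τ z₁ z₂ →
      PhiTilde m τ z₁ z₂ t = phiTilde m τ (-(z₁ + z₂) / 2) ((z₁ - z₂) / 2) t ∧
      PhiTilde m (-1 / τ) (z₁ / τ) (z₂ / τ) (t - z₁ * z₂ / τ) = τ * PhiTilde m τ z₁ z₂ t ∧
      (∀ a b : ℤ, PhiTilde m τ (z₁ + a) (z₂ + b) t = PhiTilde m τ z₁ z₂ t) ∧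
      (PhiTilde m τ (-z₁) (-z₂) t = -PhiTilde m τ z₁ z₂ t ∧
        PhiTilde m τ z₂ z₁ t = PhiTilde m τ z₁ z₂ t) ∧
      PhiTilde m (τ + 1) z₁ z₂ t = PhiTilde m τ z₁ z₂ t ∧
      (∀ j k : ℤ, PhiTilde m τ (z₁ + j * τ) (z₂ + k * τ) t =
        qPow τ (-((m + 1) * j * k)) *
          Complex.exp (-(2 * Real.pi * Complex.I * (m + 1) * (k * z₁ + j * z₂))) *
          PhiTilde m τ z₁ z₂ t)) := by
  refine ⟨fun τ hτ => ⟨summable_thetaTerm hτ, fun j v => (summable_zwegersTerm hτ v).subtype _,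
    fun z₁ z₂ h => summable_numeratorTerm m hτ h⟩, fun τ u v t hτ h => ?_, fun τ z₁ z₂ t hτ h => ?_⟩
  · obtain ⟨hsub, h₂⟩ := isRegular_iff_offLattice.mp h
    have h₁ : OffLattice τ (u - v) := by simpa using hsub.neg
    exact ⟨phiTilde_neg_one_div m hτ h₁ h₂ t,
      fun a b hab => phiTilde_add_real m hτ h₁ h₂ t hab,
      ⟨phiTilde_neg_right m hτ h₁ h₂ t, phiTilde_neg_left m hτ h₁ h₂ t⟩,
      phiTilde_tau_add_one m hτ h₁ h₂ t,
      fun a b hab => phiTilde_add_mul_tau m hτ h₁ h₂ t hab⟩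
  · exact ⟨PhiTilde_eq_phiTilde m τ z₁ z₂ t,
      PhiTilde_neg_one_div m hτ h t,
      PhiTilde_add_intCast m hτ h t,
      ⟨PhiTilde_neg_neg m hτ h t, PhiTilde_swap m hτ h t⟩,
      PhiTilde_tau_add_one m hτ h t,
      PhiTilde_add_intCast_mul_tau m hτ h t⟩
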